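/- A finite crossed module $\mathcal X=(G,M,\mu,\partial)$ consists of finite groups $G,M$, a right action $(m,g)\mapsto m^g$ of $G$ on $M$ by automorphisms, and a homomorphism $\partial:M\to G$ with $\partial(m^g)=g^{-1}(\partial m)g$ and $m^{\partial n}=n^{-1}mn$; put $K=\ker\partial$, $I=\operatorname{im}\partial$, $C=G/I$. For a finite group $H$, $\mathcal DH$ denotes the crossed module $(H,H,\mu,\mathrm{id})$ with $\mu(m,g)=g^{-1}mg$. An isomorphism of crossed modules is a pair of group isomorphisms compatible with the actions and the boundary maps. Let $\mathcal M(\mathcal X)$ be the $\mathbb C$-linear category whose objects are triples $(V,P,Q)$ with $V$ a finite-dimensional complex vector space, $P:M\to\mathrm{End}(V)$ and $Q:G\to GL(V)$ satisfying $$P(m)P(n)=\delta(m,n)P(m),\quad \sum_{m\in M} P(m)=\mathrm{id}_V,\quad Q(g)Q(h)=Q(gh),\quad P(m)Q(g)=Q(g)P(m^g),$$ and whose morphisms are the linear maps commuting with all $P(m)$ and $Q(g)$. It is a ribbon category with tensor product $(V_1\otimes V_2,\ \sum_n P_1(n)\otimes P_2(n^{-1}m),\ Q_1(g)\otimes Q_2(g))$,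 identity object $\underline{\mathbf 1}=(\mathbb C,\ \delta(m,1)\,\mathrm{id},\ \mathrm{id})$, the associativity and unit isomorphisms of vector spaces, braiding $v_1\otimes v_2\mapsto\sum_{m}Q_2(\partial m)v_2\otimes P_1(m)v_1$, duals $(V^*,\ P(m^{-1})^{t},\ Q(g^{-1})^{t})$ and twist $\sum_m Q(\partial m)P(m)$. It is called modular if it is a modular tensor category, i.e. it has finite-dimensional morphism spaces and simple unit, is semisimple with finitely many isomorphism classes of simple objects, and the matrix of quantum traces of the double braidings of the simple objects is invertible. An object is irreducible if it is nonzero and has no nontrivial subspace invariant under all $P(m)$ and $Q(g)$; $\mathrm{Irr}(\mathcal X)$ is the set of isomorphism classes of irreducible objects, and $\psi_p(m,g)=\mathrm{Tr}_V(P(m)Q(g))$ is the character of $p=[(V,P,Q)]\in\mathrm{Irr}(\mathcal X)$. The vacuum is the object $\underline{\mathbf 0}$ formed by the functions $\varphi$ on $K\times C$, with $(P(m)\varphi)(x,Iy)=\delta(m,x^y)\,\varphi(x,Iy)$ and $(Q(g)\varphi)(x,Iy)=\varphi(x,Iyg)$. Its constituents are the irreducible objects that occur as direct summands of it. **Theorem.**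 For every finite crossed module $\mathcal X$ the set $\mathrm{Irr}(\mathcal X)$ is finite, and the following are equivalent: 1. the matrix $S_{pq}=\dfrac{1}{|M|\,|C|}\displaystyle\sum_{m,n\in M}\overline{\psi_p(m,\partial n)\,\psi_q(n,\partial m)}$, $p,q\in\mathrm{Irr}(\mathcal X)$, is invertible; 2. $\mathcal M(\mathcal X)$ is modular; 3. up to isomorphism, the identity object $\underline{\mathbf 1}$ is the only constituent of the vacuum $\underline{\mathbf 0}$; 4. the boundary map $\partial$ is bijective; 5. $\mathcal X\cong\mathcal DH$ for some finite group $H$. -/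

import Mathlib

open CategoryTheory MonoidalCategory
open scoped TensorProduct ComplexConjugate

/-! ### Ribbon categories and modular tensor categories -/

/-- A twist (ribbon structure) on a braided monoidal category with duals. -/
class RibbonCategory (C : Type*) [Category C] [MonoidalCategory C] [BraidedCategory C]
    [RightRigidCategory C] where
  twist : ∀ A : C, A ≅ A
  twist_naturality : ∀ {A B : C} (f : A ⟶ B), f ≫ (twist B).hom = (twist A).hom ≫ f
  twist_tensor : ∀ A B : C, (twist (A ⊗ B)).hom =
    ((twist A).hom ⊗ₘ (twist B).hom) ≫ (β_ A B).hom ≫ (β_ B A).hom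
  twist_dual : ∀ A : C, (twist (Aᘁ)).hom = (((twist A).hom)ᘁ)

/-- The quantum trace of an endomorphism in a ribbon category,
`𝟙 ⟶ A ⊗ A* ⟶ A ⊗ A* ⟶ A* ⊗ A ⟶ 𝟙`. -/
def ribbonTrace {C : Type*} [Category C] [MonoidalCategory C] [BraidedCategory C]
    [RightRigidCategory C] [RibbonCategory C] {A : C} (f : A ⟶ A) : End (𝟙_ C) :=
  η_ A (Aᘁ) ≫ ((f ≫ (RibbonCategory.twist A).hom) ▷ (Aᘁ)) ≫ (β_ A (Aᘁ)).hom ≫ ε_ A (Aᘁ)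

/-- A `ℂ`-linear ribbon category (with finite direct sums) is a modular tensor category if it has
finite-dimensional morphism spaces, simple unit, is semisimple, has finitely many isomorphism
classes of simple objects, and the matrix of quantum traces of the double braidings of the simple
objects is invertible. -/
structure IsModularTensorCategory (C : Type*) [Category C] [Preadditive C] [Linear ℂ C]
    [Limits.HasFiniteBiproducts C] [MonoidalCategory C] [MonoidalPreadditive C]
    [MonoidalLinear ℂ C] [BraidedCategory C] [RightRigidCategory C] [RibbonCategory C] :
    Prop where
  finite_hom : ∀ A B : C, FiniteDimensional ℂ (A ⟶ B)
  simple_unit : Simple (𝟙_ C)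
  semisimple : ∀ A : C, ∃ (n : ℕ) (V : Fin n → C), (∀ i, Simple (V i)) ∧ Nonempty (A ≅ ⨁ V)
  nondegenerate : ∃ (n : ℕ) (V : Fin n → C), (∀ i, Simple (V i)) ∧
    (∀ A : C, Simple A → ∃! i, Nonempty (A ≅ V i)) ∧
    IsUnit (Matrix.of fun i j => ribbonTrace ((β_ (V i) (V j)).hom ≫ (β_ (V j) (V i)).hom))

/-! ### Crossed modules -/

/-- A crossed module: groups `G`, `M`, a right action `m ^ g = act m g` of `G` on `M` by
automorphisms, and the boundary map `∂ = bd`. -/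
structure CrossedModule (G M : Type*) [Group G] [Group M] where
  act : M → G → M
  act_one : ∀ m, act m 1 = m
  act_mul : ∀ m g h, act m (g * h) = act (act m g) h
  mul_act : ∀ m n g, act (m * n) g = act m g * act n g
  bd : M →* G
  bd_act : ∀ m g, bd (act m g) = g⁻¹ * bd m * g
  act_bd : ∀ m n, act m (bd n) = n⁻¹ * m * n

namespace CrossedModule

/-- The crossed module `𝓓G`: the identity map of `G`, with the conjugation action. -/
def double (G : Type*) [Group G] : CrossedModule G G where
  act m g := g⁻¹ * m * g
  act_one := by simp
  act_mul := by intros; group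
  mul_act := by intros; group
  bd := MonoidHom.id G
  bd_act := by simp
  act_bd := by simp

/-- Morphisms of crossed modules. -/
structure Morphism {G M G' M' : Type*} [Group G] [Group M] [Group G'] [Group M']
    (X : CrossedModule G M) (Y : CrossedModule G' M') where
  map₁ : G →* G'
  map₂ : M →* M'
  bd_map : ∀ m, Y.bd (map₂ m) = map₁ (X.bd m)
  act_map : ∀ m g, Y.act (map₂ m) (map₁ g) = map₂ (X.act m g)

/-- Two crossed modules are isomorphic if there are mutually inverse morphisms between them. -/
def Isomorphic {G M G' M' : Type*} [Group G] [Group M] [Group G'] [Group M']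
    (X : CrossedModule G M) (Y : CrossedModule G' M') : Prop :=
  ∃ (f : Morphism X Y) (h : Morphism Y X),
    (∀ g, h.map₁ (f.map₁ g) = g) ∧ (∀ g, f.map₁ (h.map₁ g) = g) ∧
    (∀ m, h.map₂ (f.map₂ m) = m) ∧ (∀ m, f.map₂ (h.map₂ m) = m)

theorem one_act {G M : Type*} [Group G] [Group M] (X : CrossedModule G M) (g : G) :
    X.act 1 g = 1 := by
  have h := X.mul_act 1 1 g
  rw [mul_one] at h
  exact left_eq_mul.mp h

theorem inv_act {G M : Type*} [Group G] [Group M] (X : CrossedModule G M) (m : M) (g : G) :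
    X.act m⁻¹ g = (X.act m g)⁻¹ := by
  rw [eq_inv_iff_mul_eq_one, ← X.mul_act, inv_mul_cancel, X.one_act]

/-- The permutation `m ↦ m ^ g` of `M`. -/
def actEquiv {G M : Type*} [Group G] [Group M] (X : CrossedModule G M) (g : G) : M ≃ M where
  toFun m := X.act m g
  invFun m := X.act m g⁻¹
  left_inv m := by simp [← X.act_mul, X.act_one]
  right_inv m := by simp [← X.act_mul, X.act_one]

/-- The image of the boundary map is a normal subgroup. -/
instance range_normal {G M : Type*} [Group G] [Group M] (X : CrossedModule G M) :
    X.bd.range.Normal where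
  conj_mem := by
    rintro _ ⟨m, rfl⟩ g
    exact ⟨X.act m g⁻¹, by rw [X.bd_act, inv_inv]⟩

/-- The cokernel of the boundary map. -/
abbrev Coker {G M : Type*} [Group G] [Group M] (X : CrossedModule G M) : Type _ :=
  G ⧸ X.bd.range

theorem ker_comm {G M : Type*} [Group G] [Group M] (X : CrossedModule G M) {k : M}
    (hk : X.bd k = 1) (n : M) : k * n = n * k := by
  have h := X.act_bd n k
  rw [hk, X.act_one] at h
  have h' := congrArg (fun x => k * x) h
  simpa [mul_assoc] using h'

/-- The element `x ^ y` of `M`, for `x ∈ ker ∂` and a coset `I y ∈ coker ∂`. -/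
def kerAct {G M : Type*} [Group G] [Group M] (X : CrossedModule G M)
    (x : X.bd.ker) (c : X.Coker) : M :=
  Quotient.liftOn' c (fun y => X.act x y) fun y z h => by
    obtain ⟨n, hn⟩ := QuotientGroup.leftRel_apply.mp h
    have hz : z = y * X.bd n := by rw [hn]; group
    have hx : X.bd (X.act x y) = 1 := by rw [X.bd_act, MonoidHom.mem_ker.mp x.2]; group
    change X.act x y = X.act x z
    rw [hz, X.act_mul, X.act_bd, mul_assoc, X.ker_comm hx, inv_mul_cancel_left]

theorem kerAct_mul {G M : Type*} [Group G] [Group M] (X : CrossedModule G M)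
    (x : X.bd.ker) (c : X.Coker) (g : G) :
    X.kerAct x (c * (g : X.Coker)) = X.act (X.kerAct x c) g := by
  induction c using QuotientGroup.induction_on with
  | H y => exact X.act_mul x y g

/-! ### The category of a finite crossed module -/

variable {G M : Type} [Group G] [Group M]

open Classical in
/-- The (finite-dimensional) objects `(V, P, Q)` of the category attached to `X`.  As `Q` is a
monoid homomorphism on the group `G`, its values are invertible. -/
structure Obj [Fintype M] (X : CrossedModule G M) where
  V : Type
  [addCommGroup : AddCommGroup V]
  [module : Module ℂ V]
  [finite : FiniteDimensional ℂ V]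
  P : M → V →ₗ[ℂ] V
  Q : G →* (V →ₗ[ℂ] V)
  P_mul : ∀ m n, P m * P n = if m = n then P m else 0
  P_sum : ∑ m, P m = 1
  P_Q : ∀ m g, P m * Q g = Q g * P (X.act m g)

attribute [instance] Obj.addCommGroup Obj.module Obj.finite

variable [Fintype M] {X : CrossedModule G M}

namespace Obj

theorem P_mul_apply (A : Obj X) (m n : M) (v : A.V) :
    A.P m (A.P n v) = open Classical in if m = n then A.P m v else 0 := by
  have := LinearMap.congr_fun (A.P_mul m n) v
  rw [Module.End.mul_apply] at this
  rw [this]; split_ifs <;> rfl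

theorem P_Q_apply (A : Obj X) (m : M) (g : G) (v : A.V) :
    A.P m (A.Q g v) = A.Q g (A.P (X.act m g) v) :=
  LinearMap.congr_fun (A.P_Q m g) v

theorem Q_mul_apply (A : Obj X) (g h : G) (v : A.V) :
    A.Q (g * h) v = A.Q g (A.Q h v) :=
  LinearMap.congr_fun (A.Q.map_mul g h) v

theorem Q_one_apply (A : Obj X) (v : A.V) : A.Q 1 v = v :=
  LinearMap.congr_fun A.Q.map_one v

theorem P_sum_apply (A : Obj X) (v : A.V) : ∑ m, A.P m v = v := by
  have := LinearMap.congr_fun A.P_sum v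
  rwa [LinearMap.sum_apply] at this

/-- Morphisms: linear maps that commute with all `P m` and `Q g`. -/
@[ext]
structure Hom (A B : Obj X) where
  lin : A.V →ₗ[ℂ] B.V
  comm_P : ∀ m v, lin (A.P m v) = B.P m (lin v)
  comm_Q : ∀ g v, lin (A.Q g v) = B.Q g (lin v)

instance category : Category (Obj X) where
  Hom := Hom
  id A := ⟨LinearMap.id, fun _ _ => rfl, fun _ _ => rfl⟩
  comp f g := ⟨g.lin ∘ₗ f.lin, fun m v => by simp [f.comm_P, g.comm_P],
    fun m v => by simp [f.comm_Q, g.comm_Q]⟩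

theorem hom_ext {A B : Obj X} {f g : A ⟶ B} (h : ∀ v, Hom.lin f v = Hom.lin g v) : f = g :=
  Hom.ext (LinearMap.ext h)

@[simp] theorem id_lin (A : Obj X) : Hom.lin (𝟙 A) = LinearMap.id := rfl

@[simp] theorem comp_lin {A B C : Obj X} (f : A ⟶ B) (g : B ⟶ C) :
    Hom.lin (f ≫ g) = Hom.lin g ∘ₗ Hom.lin f := rfl

/-- An invertible linear map commuting with `P` and `Q` is an isomorphism. -/
def isoMk {A B : Obj X} (e : A.V ≃ₗ[ℂ] B.V) (hP : ∀ m v, e (A.P m v) = B.P m (e v))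
    (hQ : ∀ g v, e (A.Q g v) = B.Q g (e v)) : A ≅ B where
  hom := (⟨e.toLinearMap, hP, hQ⟩ : Hom A B)
  inv := (⟨e.symm.toLinearMap, fun m v => by simp [LinearEquiv.symm_apply_eq, hP],
    fun m v => by simp [LinearEquiv.symm_apply_eq, hQ]⟩ : Hom B A)
  hom_inv_id := hom_ext fun v => e.symm_apply_apply v
  inv_hom_id := hom_ext fun v => e.apply_symm_apply v

/-- The linear equivalence underlying an isomorphism. -/
def isoLin {A B : Obj X} (e : A ≅ B) : A.V ≃ₗ[ℂ] B.V :=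
  LinearEquiv.ofLinearMap (Hom.lin e.hom) (Hom.lin e.inv)
    (congrArg Hom.lin e.inv_hom_id) (congrArg Hom.lin e.hom_inv_id)

/-! Linear structure and direct sums. -/

theorem isoLin_P {A B : Obj X} (e : A ≅ B) (m : M) (v : A.V) :
    isoLin e (A.P m v) = B.P m (isoLin e v) := Hom.comm_P e.hom m v

theorem isoLin_Q {A B : Obj X} (e : A ≅ B) (g : G) (v : A.V) :
    isoLin e (A.Q g v) = B.Q g (isoLin e v) := Hom.comm_Q e.hom g v

instance homZero (A B : Obj X) : Zero (A ⟶ B) := ⟨(⟨0, by simp, by simp⟩ : Hom A B)⟩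

instance homAdd (A B : Obj X) : Add (A ⟶ B) := ⟨fun f g => (⟨Hom.lin f + Hom.lin g,
  by simp [Hom.comm_P], by simp [Hom.comm_Q]⟩ : Hom A B)⟩

instance homNeg (A B : Obj X) : Neg (A ⟶ B) := ⟨fun f => (⟨-Hom.lin f,
  by simp [Hom.comm_P], by simp [Hom.comm_Q]⟩ : Hom A B)⟩

instance homAddCommGroup (A B : Obj X) : AddCommGroup (A ⟶ B) where
  add_assoc f g h := Hom.ext (add_assoc (Hom.lin f) (Hom.lin g) (Hom.lin h))
  zero_add f := Hom.ext (zero_add (Hom.lin f))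
  add_zero f := Hom.ext (add_zero (Hom.lin f))
  add_comm f g := Hom.ext (add_comm (Hom.lin f) (Hom.lin g))
  neg_add_cancel f := Hom.ext (neg_add_cancel (Hom.lin f))
  nsmul := nsmulRec
  zsmul := zsmulRec

@[simp] theorem zero_lin (A B : Obj X) : Hom.lin (0 : A ⟶ B) = 0 := rfl

@[simp] theorem add_lin {A B : Obj X} (f g : A ⟶ B) :
    Hom.lin (f + g) = Hom.lin f + Hom.lin g := rfl

instance homModule (A B : Obj X) : Module ℂ (A ⟶ B) where
  smul r f := (⟨r • Hom.lin f, by simp [Hom.comm_P], by simp [Hom.comm_Q]⟩ : Hom A B)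
  one_smul f := Hom.ext (one_smul ℂ (Hom.lin f))
  mul_smul r s f := Hom.ext (mul_smul r s (Hom.lin f))
  smul_zero r := Hom.ext (smul_zero r)
  smul_add r f g := Hom.ext (smul_add r (Hom.lin f) (Hom.lin g))
  add_smul r s f := Hom.ext (add_smul r s (Hom.lin f))
  zero_smul f := Hom.ext (zero_smul ℂ (Hom.lin f))

@[simp] theorem smul_lin {A B : Obj X} (r : ℂ) (f : A ⟶ B) :
    Hom.lin (r • f) = r • Hom.lin f := rfl

instance preadditive : Preadditive (Obj X) where
  homGroup := homAddCommGroup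
  add_comp _ _ _ f g h := hom_ext fun v => map_add (Hom.lin h) (Hom.lin f v) (Hom.lin g v)
  comp_add _ _ _ _ _ _ := hom_ext fun _ => rfl

instance linear : Linear ℂ (Obj X) where
  homModule := homModule
  smul_comp _ _ _ r f g := Hom.ext (LinearMap.comp_smul (Hom.lin g) r (Hom.lin f))
  comp_smul _ _ _ f r g := Hom.ext (LinearMap.smul_comp r (Hom.lin g) (Hom.lin f))

/-- The direct sum of two objects. -/
def directSum (A B : Obj X) : Obj X where
  V := A.V × B.V
  P m := (A.P m).prodMap (B.P m)
  Q := { toFun := fun g => (A.Q g).prodMap (B.Q g)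
         map_one' := LinearMap.ext fun v => by simp
         map_mul' := fun g h => LinearMap.ext fun v => by simp }
  P_mul m n := by
    refine LinearMap.ext fun v => ?_
    rw [Module.End.mul_apply]
    simp only [LinearMap.prodMap_apply, P_mul_apply]
    split_ifs <;> rfl
  P_sum := by
    refine LinearMap.ext fun v => ?_
    rw [LinearMap.sum_apply]
    ext <;> simp [Prod.fst_sum, Prod.snd_sum, P_sum_apply]
  P_Q m g := LinearMap.ext fun v => by simp [P_Q_apply]

/-- The zero object. -/
def zeroObj (X : CrossedModule G M) : Obj X where
  V := PUnit
  P _ := 0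
  Q := 1
  P_mul _ _ := LinearMap.ext fun _ => rfl
  P_sum := LinearMap.ext fun _ => rfl
  P_Q _ _ := LinearMap.ext fun _ => rfl

instance hasZeroObject : Limits.HasZeroObject (Obj X) where
  zero := ⟨zeroObj X, (Limits.IsZero.iff_id_eq_zero _).mpr (hom_ext fun _ => rfl)⟩

/-- The direct sum is a biproduct. -/
def directSumBicone (A B : Obj X) : Limits.BinaryBicone A B where
  pt := directSum A B
  fst := (⟨LinearMap.fst ℂ A.V B.V, fun _ _ => rfl, fun _ _ => rfl⟩ : Hom (directSum A B) A)
  snd := (⟨LinearMap.snd ℂ A.V B.V, fun _ _ => rfl, fun _ _ => rfl⟩ : Hom (directSum A B) B)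
  inl := (⟨LinearMap.inl ℂ A.V B.V, fun m _ => Prod.ext rfl (map_zero (B.P m)).symm,
    fun m _ => Prod.ext rfl (map_zero (B.Q m)).symm⟩ : Hom A (directSum A B))
  inr := (⟨LinearMap.inr ℂ A.V B.V, fun m _ => Prod.ext (map_zero (A.P m)).symm rfl,
    fun m _ => Prod.ext (map_zero (A.Q m)).symm rfl⟩ : Hom B (directSum A B))
  inl_fst := hom_ext fun _ => rfl
  inl_snd := hom_ext fun _ => rfl
  inr_fst := hom_ext fun _ => rfl
  inr_snd := hom_ext fun _ => rfl

instance hasBinaryBiproducts : Limits.HasBinaryBiproducts (Obj X) where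
  has_binary_biproduct A B := Limits.hasBinaryBiproduct_of_total (directSumBicone A B)
    (hom_ext fun v => Prod.ext (add_zero (v : A.V × B.V).1) (zero_add (v : A.V × B.V).2))

instance hasFiniteBiproducts : Limits.HasFiniteBiproducts (Obj X) :=
  haveI : Limits.HasFiniteProducts (Obj X) :=
    hasFiniteProducts_of_has_binary_and_terminal
  Limits.HasFiniteBiproducts.of_hasFiniteProducts

/-! The braided tensor structure. -/

section operators

variable {V W Z : Type} [AddCommGroup V] [Module ℂ V] [AddCommGroup W] [Module ℂ W]
  [AddCommGroup Z] [Module ℂ Z]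

/-- The operator `∑ₙ P₁(n) ⊗ P₂(n⁻¹ m)`. -/
noncomputable def convP (P₁ : M → V →ₗ[ℂ] V) (P₂ : M → W →ₗ[ℂ] W) (m : M) :
    V ⊗[ℂ] W →ₗ[ℂ] V ⊗[ℂ] W :=
  ∑ n : M, TensorProduct.map (P₁ n) (P₂ (n⁻¹ * m))

theorem convP_tmul (P₁ : M → V →ₗ[ℂ] V) (P₂ : M → W →ₗ[ℂ] W) (m : M) (v : V) (w : W) :
    convP P₁ P₂ m (v ⊗ₜ w) = ∑ n : M, P₁ n v ⊗ₜ[ℂ] P₂ (n⁻¹ * m) w := by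
  simp [convP, LinearMap.sum_apply]

/-- The operators `Q₁(g) ⊗ Q₂(g)`. -/
noncomputable def tensorQ (Q₁ : G →* (V →ₗ[ℂ] V)) (Q₂ : G →* (W →ₗ[ℂ] W)) :
    G →* (V ⊗[ℂ] W →ₗ[ℂ] V ⊗[ℂ] W) where
  toFun g := TensorProduct.map (Q₁ g) (Q₂ g)
  map_one' := by simp
  map_mul' g h := by simp [TensorProduct.map_mul]

theorem tensorQ_tmul (Q₁ : G →* (V →ₗ[ℂ] V)) (Q₂ : G →* (W →ₗ[ℂ] W)) (g : G) (v : V) (w : W) :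
    tensorQ Q₁ Q₂ g (v ⊗ₜ w) = Q₁ g v ⊗ₜ[ℂ] Q₂ g w := rfl

/-- The operator `δ(m, 1)` on `ℂ`. -/
noncomputable def unitP (m : M) : ℂ →ₗ[ℂ] ℂ := open Classical in if m = 1 then 1 else 0

theorem unitP_apply (m : M) (z : ℂ) : unitP m z = open Classical in if m = 1 then z else 0 := by
  simp only [unitP]; split_ifs <;> rfl

/-- Two linear maps out of a tensor product that agree on pure tensors agree. -/
theorem eq_of_tmul (f g : V ⊗[ℂ] W →ₗ[ℂ] Z) (h : ∀ v w, f (v ⊗ₜ w) = g (v ⊗ₜ w))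
    (x : V ⊗[ℂ] W) : f x = g x :=
  LinearMap.congr_fun (TensorProduct.ext' h) x

theorem convP_assoc (P₁ : M → V →ₗ[ℂ] V) (P₂ : M → W →ₗ[ℂ] W) (P₃ : M → Z →ₗ[ℂ] Z) (m : M)
    (x : (V ⊗[ℂ] W) ⊗[ℂ] Z) :
    TensorProduct.assoc ℂ V W Z (convP (convP P₁ P₂) P₃ m x) =
      convP P₁ (convP P₂ P₃) m (TensorProduct.assoc ℂ V W Z x) := by
  refine LinearMap.congr_fun (f := (TensorProduct.assoc ℂ V W Z).toLinearMap ∘ₗ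
    convP (convP P₁ P₂) P₃ m) (g := convP P₁ (convP P₂ P₃) m ∘ₗ
    (TensorProduct.assoc ℂ V W Z).toLinearMap) (TensorProduct.ext_threefold fun u v w => ?_) x
  simp only [convP_tmul, TensorProduct.sum_tmul, TensorProduct.tmul_sum, map_sum,
    LinearEquiv.coe_coe, TensorProduct.assoc_tmul, LinearMap.comp_apply]
  rw [Finset.sum_comm]
  refine Finset.sum_congr rfl fun n _ => ?_
  rw [← Equiv.sum_comp (Equiv.mulLeft n)]
  refine Finset.sum_congr rfl fun k _ => ?_
  simp [mul_assoc]

theorem convP_unit_left (P : M → V →ₗ[ℂ] V) (m : M) (x : ℂ ⊗[ℂ] V) :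
    TensorProduct.lid ℂ V (convP unitP P m x) = P m (TensorProduct.lid ℂ V x) := by
  refine eq_of_tmul ((TensorProduct.lid ℂ V).toLinearMap ∘ₗ convP unitP P m)
    (P m ∘ₗ (TensorProduct.lid ℂ V).toLinearMap) (fun z v => ?_) x
  simp only [LinearMap.comp_apply, convP_tmul, LinearEquiv.coe_coe, map_sum,
    TensorProduct.lid_tmul]
  rw [Finset.sum_eq_single 1]
  · simp [unitP_apply]
  · intro b _ hb; simp [unitP_apply, hb]
  · simp

theorem convP_unit_right (P : M → V →ₗ[ℂ] V) (m : M) (x : V ⊗[ℂ] ℂ) :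
    TensorProduct.rid ℂ V (convP P unitP m x) = P m (TensorProduct.rid ℂ V x) := by
  refine eq_of_tmul ((TensorProduct.rid ℂ V).toLinearMap ∘ₗ convP P unitP m)
    (P m ∘ₗ (TensorProduct.rid ℂ V).toLinearMap) (fun v z => ?_) x
  simp only [LinearMap.comp_apply, convP_tmul, LinearEquiv.coe_coe, map_sum,
    TensorProduct.rid_tmul]
  rw [Finset.sum_eq_single m]
  · simp [unitP_apply]
  · intro b _ hb
    have : b⁻¹ * m ≠ 1 := fun h => hb (inv_mul_eq_one.mp h)
    simp [unitP_apply, this]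
  · simp

/-- The braiding `v ⊗ w ↦ ∑ₘ Q₂(∂m) w ⊗ P₁(m) v`. -/
noncomputable def braidMap (X : CrossedModule G M) (P₁ : M → V →ₗ[ℂ] V) (Q₂ : G →* (W →ₗ[ℂ] W)) :
    V ⊗[ℂ] W →ₗ[ℂ] W ⊗[ℂ] V :=
  ∑ m : M, TensorProduct.map (Q₂ (X.bd m)) (P₁ m) ∘ₗ (TensorProduct.comm ℂ V W).toLinearMap

theorem braidMap_tmul (X : CrossedModule G M) (P₁ : M → V →ₗ[ℂ] V) (Q₂ : G →* (W →ₗ[ℂ] W))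
    (v : V) (w : W) :
    braidMap X P₁ Q₂ (v ⊗ₜ w) = ∑ m : M, Q₂ (X.bd m) w ⊗ₜ[ℂ] P₁ m v := by
  simp [braidMap, LinearMap.sum_apply]

/-- The inverse braiding `w ⊗ v ↦ ∑ₘ P₁(m) v ⊗ Q₂(∂m)⁻¹ w`. -/
noncomputable def braidInv (X : CrossedModule G M) (P₁ : M → V →ₗ[ℂ] V) (Q₂ : G →* (W →ₗ[ℂ] W)) :
    W ⊗[ℂ] V →ₗ[ℂ] V ⊗[ℂ] W :=
  ∑ m : M, TensorProduct.map (P₁ m) (Q₂ (X.bd m)⁻¹) ∘ₗ (TensorProduct.comm ℂ W V).toLinearMap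

theorem braidInv_tmul (X : CrossedModule G M) (P₁ : M → V →ₗ[ℂ] V) (Q₂ : G →* (W →ₗ[ℂ] W))
    (v : V) (w : W) :
    braidInv X P₁ Q₂ (w ⊗ₜ v) = ∑ m : M, P₁ m v ⊗ₜ[ℂ] Q₂ (X.bd m)⁻¹ w := by
  simp [braidInv, LinearMap.sum_apply]

end operators

/-- The trivial (identity) object. -/
noncomputable def trivial (X : CrossedModule G M) : Obj X where
  V := ℂ
  P := unitP
  Q := 1
  P_mul m n := by
    refine LinearMap.ext fun v => ?_
    rw [Module.End.mul_apply, unitP_apply, unitP_apply]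
    by_cases h : m = n
    · subst h; rw [if_pos rfl, unitP_apply]; split_ifs <;> rfl
    · rw [if_neg h]
      by_cases h1 : m = 1
      · subst h1; rw [if_pos rfl, if_neg (Ne.symm h)]; rfl
      · rw [if_neg h1]; rfl
  P_sum := by
    refine LinearMap.ext fun v => ?_
    rw [LinearMap.sum_apply]
    rw [Finset.sum_eq_single (1 : M)]
    · rw [unitP_apply, if_pos rfl]; rfl
    · intro b _ hb; rw [unitP_apply, if_neg hb]
    · simp
  P_Q m g := by
    refine LinearMap.ext fun v => ?_
    have : X.act m g = 1 ↔ m = 1 := by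
      constructor
      · intro h
        exact (X.actEquiv g).injective (h.trans (X.one_act g).symm)
      · rintro rfl; exact X.one_act g
    simp only [MonoidHom.one_apply, mul_one, one_mul, unitP_apply]
    split_ifs <;> simp_all

/-- The tensor product of two objects. -/
noncomputable def tensor (A B : Obj X) : Obj X where
  V := A.V ⊗[ℂ] B.V
  P := convP A.P B.P
  Q := tensorQ A.Q B.Q
  P_mul m n := by
    refine TensorProduct.ext' fun v w => ?_
    classical
    simp only [Module.End.mul_apply, convP_tmul, map_sum, P_mul_apply]
    have : ∀ x y : M, ((if x = y then A.P x v else 0) ⊗ₜ[ℂ]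
        (if x⁻¹ * m = y⁻¹ * n then B.P (x⁻¹ * m) w else 0) : A.V ⊗[ℂ] B.V) =
        if x = y then (if m = n then A.P x v ⊗ₜ[ℂ] B.P (x⁻¹ * m) w else 0) else 0 := by
      intro x y
      by_cases h : x = y
      · subst h; by_cases h' : m = n <;> simp [h']
      · simp [h]
    rw [Finset.sum_comm]
    simp only [this]
    by_cases h : m = n
    · subst h; simp [convP_tmul]
    · simp [h]
  P_sum := by
    refine TensorProduct.ext' fun v w => ?_
    rw [LinearMap.sum_apply]
    simp only [convP_tmul]
    rw [Finset.sum_comm]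
    have : ∀ n : M, ∑ m : M, A.P n v ⊗ₜ[ℂ] B.P (n⁻¹ * m) w = A.P n v ⊗ₜ[ℂ] w := by
      intro n
      rw [← TensorProduct.tmul_sum]
      exact congrArg _ ((Equiv.sum_comp (Equiv.mulLeft n⁻¹) (fun m => B.P m w)).trans
        (P_sum_apply B w))
    simp only [this]
    rw [← TensorProduct.sum_tmul, P_sum_apply]; rfl
  P_Q m g := by
    refine TensorProduct.ext' fun v w => ?_
    simp only [Module.End.mul_apply, convP_tmul, map_sum, P_Q_apply,
      X.mul_act, X.inv_act, tensorQ_tmul]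
    exact (X.actEquiv g).sum_comp
      (fun n => A.Q g (A.P n v) ⊗ₜ[ℂ] B.Q g (B.P (n⁻¹ * X.act m g) w))

/-- The tensor product of two morphisms. -/
noncomputable def tensorMap {A A' B B' : Obj X} (f : A ⟶ A') (g : B ⟶ B') :
    Hom (tensor A B) (tensor A' B') where
  lin := TensorProduct.map (Hom.lin f) (Hom.lin g)
  comm_P m := eq_of_tmul (TensorProduct.map (Hom.lin f) (Hom.lin g) ∘ₗ convP A.P B.P m)
    (convP A'.P B'.P m ∘ₗ TensorProduct.map (Hom.lin f) (Hom.lin g)) fun v w => by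
    simp [convP_tmul, Hom.comm_P]
  comm_Q m := eq_of_tmul
    (TensorProduct.map (Hom.lin f) (Hom.lin g) ∘ₗ TensorProduct.map (A.Q m) (B.Q m))
    (TensorProduct.map (A'.Q m) (B'.Q m) ∘ₗ TensorProduct.map (Hom.lin f) (Hom.lin g))
    fun v w => by simp [Hom.comm_Q]

/-- The associativity isomorphism, as for vector spaces. -/
noncomputable def assocIso (A B C : Obj X) : tensor (tensor A B) C ≅ tensor A (tensor B C) :=
  isoMk (A := tensor (tensor A B) C) (B := tensor A (tensor B C))
    (TensorProduct.assoc ℂ A.V B.V C.V) (convP_assoc A.P B.P C.P)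
    (fun g => LinearMap.congr_fun (f := (TensorProduct.assoc ℂ A.V B.V C.V).toLinearMap ∘ₗ
        TensorProduct.map (TensorProduct.map (A.Q g) (B.Q g)) (C.Q g))
      (g := TensorProduct.map (A.Q g) (TensorProduct.map (B.Q g) (C.Q g)) ∘ₗ
        (TensorProduct.assoc ℂ A.V B.V C.V).toLinearMap)
      (TensorProduct.ext_threefold fun _ _ _ => rfl))

/-- The left unit isomorphism, as for vector spaces. -/
noncomputable def leftUnitIso (A : Obj X) : tensor (trivial X) A ≅ A :=
  isoMk (A := tensor (trivial X) A) (B := A) (TensorProduct.lid ℂ A.V) (convP_unit_left A.P)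
    (fun g => eq_of_tmul ((TensorProduct.lid ℂ A.V).toLinearMap ∘ₗ TensorProduct.map 1 (A.Q g))
      (A.Q g ∘ₗ (TensorProduct.lid ℂ A.V).toLinearMap) fun z v => by simp)

/-- The right unit isomorphism, as for vector spaces. -/
noncomputable def rightUnitIso (A : Obj X) : tensor A (trivial X) ≅ A :=
  isoMk (A := tensor A (trivial X)) (B := A) (TensorProduct.rid ℂ A.V) (convP_unit_right A.P)
    (fun g => eq_of_tmul ((TensorProduct.rid ℂ A.V).toLinearMap ∘ₗ TensorProduct.map (A.Q g) 1)
      (A.Q g ∘ₗ (TensorProduct.rid ℂ A.V).toLinearMap) fun z v => by simp)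

noncomputable instance monoidalStruct : MonoidalCategoryStruct (Obj X) where
  tensorObj := tensor
  tensorHom f g := tensorMap f g
  whiskerLeft A _ _ f := tensorMap (𝟙 A) f
  whiskerRight f A := tensorMap f (𝟙 A)
  tensorUnit := trivial X
  associator := assocIso
  leftUnitor := leftUnitIso
  rightUnitor := rightUnitIso

noncomputable instance monoidalCategory : MonoidalCategory (Obj X) :=
  MonoidalCategory.ofTensorHom
    (id_tensorHom_id := fun _ _ => Hom.ext TensorProduct.map_id)
    (id_tensorHom := fun _ _ _ _ => rfl)
    (tensorHom_id := fun _ _ => rfl)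
    (tensorHom_comp_tensorHom := fun f₁ f₂ g₁ g₂ =>
      Hom.ext (TensorProduct.map_comp (Hom.lin g₁) (Hom.lin g₂) (Hom.lin f₁) (Hom.lin f₂)).symm)
    (associator_naturality := fun _ _ _ =>
      Hom.ext (TensorProduct.ext_threefold fun _ _ _ => rfl))
    (leftUnitor_naturality := fun f =>
      Hom.ext (TensorProduct.ext' fun (z : ℂ) v => (map_smul (Hom.lin f) z v).symm))
    (rightUnitor_naturality := fun f =>
      Hom.ext (TensorProduct.ext' fun v (z : ℂ) => (map_smul (Hom.lin f) z v).symm))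
    (pentagon := fun _ _ _ _ => Hom.ext (TensorProduct.ext_fourfold fun _ _ _ _ => rfl))
    (triangle := fun _ _ => Hom.ext (TensorProduct.ext_threefold fun a (z : ℂ) b =>
      (TensorProduct.smul_tmul z a b).symm))

instance monoidalPreadditive : MonoidalPreadditive (Obj X) where
  whiskerLeft_zero := Hom.ext (TensorProduct.map_zero_right _)
  zero_whiskerRight := Hom.ext (TensorProduct.map_zero_left _)
  whiskerLeft_add f g := Hom.ext (TensorProduct.map_add_right _ (Hom.lin f) (Hom.lin g))
  add_whiskerRight f g := Hom.ext (TensorProduct.map_add_left (Hom.lin f) (Hom.lin g) _)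

instance monoidalLinear : MonoidalLinear ℂ (Obj X) where
  whiskerLeft_smul _ _ _ r f := Hom.ext (TensorProduct.map_smul_right r _ (Hom.lin f))
  smul_whiskerRight r _ _ f _ := Hom.ext (TensorProduct.map_smul_left r (Hom.lin f) _)

theorem Q_inv_apply (A : Obj X) (g : G) (v : A.V) : A.Q g⁻¹ (A.Q g v) = v := by
  rw [← Q_mul_apply, inv_mul_cancel, Q_one_apply]

theorem Q_apply_inv (A : Obj X) (g : G) (v : A.V) : A.Q g (A.Q g⁻¹ v) = v := by
  rw [← Q_mul_apply, mul_inv_cancel, Q_one_apply]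

/-- `∑ₘ f(m, P(m) v)` only sees the component of `P(k) v` at `m = k`. -/
theorem sum_P_P (A : Obj X) {U : Type} [AddCommGroup U] [Module ℂ U] (F : M → A.V →ₗ[ℂ] U)
    (k : M) (v : A.V) : ∑ m, F m (A.P m (A.P k v)) = F k (A.P k v) := by
  classical
  rw [Finset.sum_eq_single k]
  · rw [P_mul_apply, if_pos rfl]
  · intro b _ hb; rw [P_mul_apply, if_neg hb, map_zero]
  · simp

theorem braidInv_braidMap (A B : Obj X) (x : A.V ⊗[ℂ] B.V) :
    braidInv X A.P B.Q (braidMap X A.P B.Q x) = x := by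
  refine eq_of_tmul (braidInv X A.P B.Q ∘ₗ braidMap X A.P B.Q) LinearMap.id (fun v w => ?_) x
  simp only [LinearMap.comp_apply, braidMap_tmul, braidInv_tmul, map_sum, LinearMap.id_apply]
  have : ∀ k : M, ∑ m, A.P m (A.P k v) ⊗ₜ[ℂ] B.Q (X.bd m)⁻¹ (B.Q (X.bd k) w) =
      A.P k v ⊗ₜ[ℂ] w := fun k => by
    refine (sum_P_P A (fun m => (TensorProduct.mk ℂ A.V B.V).flip
      (B.Q (X.bd m)⁻¹ (B.Q (X.bd k) w))) k v).trans ?_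
    rw [Q_inv_apply]; rfl
  simp only [this]
  rw [← TensorProduct.sum_tmul, P_sum_apply]

theorem braidMap_braidInv (A B : Obj X) (x : B.V ⊗[ℂ] A.V) :
    braidMap X A.P B.Q (braidInv X A.P B.Q x) = x := by
  refine eq_of_tmul (braidMap X A.P B.Q ∘ₗ braidInv X A.P B.Q) LinearMap.id (fun w v => ?_) x
  simp only [LinearMap.comp_apply, braidMap_tmul, braidInv_tmul, map_sum, LinearMap.id_apply]
  have : ∀ k : M, ∑ m, B.Q (X.bd m) (B.Q (X.bd k)⁻¹ w) ⊗ₜ[ℂ] A.P m (A.P k v) =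
      w ⊗ₜ[ℂ] A.P k v := fun k => by
    refine (sum_P_P A (fun m => TensorProduct.mk ℂ B.V A.V
      (B.Q (X.bd m) (B.Q (X.bd k)⁻¹ w))) k v).trans ?_
    rw [Q_apply_inv]; rfl
  simp only [this]
  rw [← TensorProduct.tmul_sum, P_sum_apply]

theorem braidMap_convP (A B : Obj X) (k : M) (x : A.V ⊗[ℂ] B.V) :
    braidMap X A.P B.Q (convP A.P B.P k x) = convP B.P A.P k (braidMap X A.P B.Q x) := by
  refine eq_of_tmul (braidMap X A.P B.Q ∘ₗ convP A.P B.P k)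
    (convP B.P A.P k ∘ₗ braidMap X A.P B.Q) (fun v w => ?_) x
  simp only [LinearMap.comp_apply, braidMap_tmul, convP_tmul, map_sum]
  refine Finset.sum_congr rfl fun n _ => ?_
  refine (sum_P_P A (fun m => TensorProduct.mk ℂ B.V A.V
      (B.Q (X.bd m) (B.P (n⁻¹ * k) w))) n v).trans ?_
  rw [Finset.sum_eq_single (k * n⁻¹)]
  · have h : X.act (k * n⁻¹) (X.bd n) = n⁻¹ * k := by rw [X.act_bd]; group
    have h' : (k * n⁻¹)⁻¹ * k = n := by group
    rw [P_Q_apply, h, P_mul_apply, if_pos h', h']; rfl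
  · intro b _ hb
    rw [P_mul_apply, if_neg, TensorProduct.tmul_zero]
    intro h; apply hb; rw [← h]; group
  · simp

theorem braidMap_tensorQ (A B : Obj X) (g : G) (x : A.V ⊗[ℂ] B.V) :
    braidMap X A.P B.Q (tensorQ A.Q B.Q g x) = tensorQ B.Q A.Q g (braidMap X A.P B.Q x) := by
  refine eq_of_tmul (braidMap X A.P B.Q ∘ₗ tensorQ A.Q B.Q g)
    (tensorQ B.Q A.Q g ∘ₗ braidMap X A.P B.Q) (fun v w => ?_) x
  simp only [LinearMap.comp_apply, braidMap_tmul, tensorQ_tmul, map_sum, P_Q_apply]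
  rw [← (X.actEquiv g).sum_comp fun m => B.Q g (B.Q (X.bd m) w) ⊗ₜ[ℂ] A.Q g (A.P m v)]
  refine Finset.sum_congr rfl fun m _ => ?_
  change _ = B.Q g (B.Q (X.bd (X.act m g)) w) ⊗ₜ[ℂ] A.Q g (A.P (X.act m g) v)
  rw [← Q_mul_apply, ← Q_mul_apply, X.bd_act]
  congr 3; group

/-- The braiding of two objects. -/
noncomputable def braid (A B : Obj X) : tensor A B ≅ tensor B A :=
  isoMk (A := tensor A B) (B := tensor B A)
    (LinearEquiv.ofLinearMap (braidMap X A.P B.Q) (braidInv X A.P B.Q)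
      (LinearMap.ext (braidMap_braidInv A B)) (LinearMap.ext (braidInv_braidMap A B)))
    (braidMap_convP A B) (braidMap_tensorQ A B)

theorem hexagon_forward_aux (A B C : Obj X) (x : (A.V ⊗[ℂ] B.V) ⊗[ℂ] C.V) :
    TensorProduct.assoc ℂ B.V C.V A.V (braidMap X A.P (tensorQ B.Q C.Q)
      (TensorProduct.assoc ℂ A.V B.V C.V x)) =
    TensorProduct.map LinearMap.id (braidMap X A.P C.Q) (TensorProduct.assoc ℂ B.V A.V C.V
      (TensorProduct.map (braidMap X A.P B.Q) LinearMap.id x)) := by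
  refine LinearMap.congr_fun (f := (TensorProduct.assoc ℂ B.V C.V A.V).toLinearMap ∘ₗ
    braidMap X A.P (tensorQ B.Q C.Q) ∘ₗ (TensorProduct.assoc ℂ A.V B.V C.V).toLinearMap)
    (g := TensorProduct.map LinearMap.id (braidMap X A.P C.Q) ∘ₗ
      (TensorProduct.assoc ℂ B.V A.V C.V).toLinearMap ∘ₗ
      TensorProduct.map (braidMap X A.P B.Q) LinearMap.id)
    (TensorProduct.ext_threefold fun u v w => ?_) x
  simp only [LinearMap.comp_apply, LinearEquiv.coe_coe, TensorProduct.assoc_tmul, braidMap_tmul,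
    TensorProduct.map_tmul, LinearMap.id_apply, map_sum, TensorProduct.sum_tmul, tensorQ_tmul,
    TensorProduct.tmul_sum]
  refine Finset.sum_congr rfl fun k _ => ?_
  exact (sum_P_P A (fun m => TensorProduct.mk ℂ B.V (C.V ⊗[ℂ] A.V) (B.Q (X.bd k) v) ∘ₗ
    TensorProduct.mk ℂ C.V A.V (C.Q (X.bd m) w)) k u).symm

theorem hexagon_reverse_aux (A B C : Obj X) (x : A.V ⊗[ℂ] (B.V ⊗[ℂ] C.V)) :
    (TensorProduct.assoc ℂ C.V A.V B.V).symm (braidMap X (convP A.P B.P) C.Q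
      ((TensorProduct.assoc ℂ A.V B.V C.V).symm x)) =
    TensorProduct.map (braidMap X A.P C.Q) LinearMap.id ((TensorProduct.assoc ℂ A.V C.V B.V).symm
      (TensorProduct.map LinearMap.id (braidMap X B.P C.Q) x)) := by
  obtain ⟨x, rfl⟩ := (TensorProduct.assoc ℂ A.V B.V C.V).surjective x
  rw [LinearEquiv.symm_apply_apply]
  refine LinearMap.congr_fun (f := (TensorProduct.assoc ℂ C.V A.V B.V).symm.toLinearMap ∘ₗ
    braidMap X (convP A.P B.P) C.Q)
    (g := TensorProduct.map (braidMap X A.P C.Q) LinearMap.id ∘ₗ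
      (TensorProduct.assoc ℂ A.V C.V B.V).symm.toLinearMap ∘ₗ
      TensorProduct.map LinearMap.id (braidMap X B.P C.Q) ∘ₗ
      (TensorProduct.assoc ℂ A.V B.V C.V).toLinearMap)
    (TensorProduct.ext_threefold fun u v w => ?_) x
  simp only [LinearMap.comp_apply, LinearEquiv.coe_coe, TensorProduct.assoc_tmul, braidMap_tmul,
    TensorProduct.map_tmul, LinearMap.id_apply, map_sum, TensorProduct.sum_tmul, convP_tmul,
    TensorProduct.tmul_sum, TensorProduct.assoc_symm_tmul]
  rw [Finset.sum_comm, Finset.sum_comm (s := Finset.univ) (t := Finset.univ)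
    (f := fun i j => (C.Q (X.bd j) (C.Q (X.bd i) w) ⊗ₜ[ℂ] A.P j u) ⊗ₜ[ℂ] B.P i v)]
  refine Finset.sum_congr rfl fun n _ => ?_
  rw [← Equiv.sum_comp (Equiv.mulLeft n)]
  refine Finset.sum_congr rfl fun k _ => ?_
  rw [← Q_mul_apply, ← map_mul, Equiv.coe_mulLeft, inv_mul_cancel_left]

noncomputable instance braidedCategory : BraidedCategory (Obj X) where
  braiding := braid
  braiding_naturality_right A B C f := Hom.ext <| TensorProduct.ext' fun v w => by
    change braidMap X A.P C.Q (v ⊗ₜ Hom.lin f w) =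
      TensorProduct.map (Hom.lin f) LinearMap.id (braidMap X A.P B.Q (v ⊗ₜ w))
    simp [braidMap_tmul, Hom.comm_Q]
  braiding_naturality_left {A B} f C := Hom.ext <| TensorProduct.ext' fun v w => by
    change braidMap X B.P C.Q (Hom.lin f v ⊗ₜ w) =
      TensorProduct.map LinearMap.id (Hom.lin f) (braidMap X A.P C.Q (v ⊗ₜ w))
    simp [braidMap_tmul, Hom.comm_P]
  hexagon_forward A B C := hom_ext (hexagon_forward_aux A B C)
  hexagon_reverse A B C := hom_ext (hexagon_reverse_aux A B C)

/-! Duals. -/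

/-- The operators `P*(m) = P(m⁻¹)ᵗ` on the dual space. -/
def dualP (A : Obj X) (m : M) : Module.Dual ℂ A.V →ₗ[ℂ] Module.Dual ℂ A.V := (A.P m⁻¹).dualMap

/-- The operators `Q*(g) = Q(g⁻¹)ᵗ` on the dual space. -/
def dualQ (A : Obj X) : G →* (Module.Dual ℂ A.V →ₗ[ℂ] Module.Dual ℂ A.V) where
  toFun g := (A.Q g⁻¹).dualMap
  map_one' := LinearMap.ext fun f => LinearMap.ext fun v => by simp
  map_mul' g h := LinearMap.ext fun f => LinearMap.ext fun v => by simp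

/-- The dual object. -/
def dual (A : Obj X) : Obj X where
  V := Module.Dual ℂ A.V
  P := dualP A
  Q := dualQ A
  P_mul m n := LinearMap.ext fun f => LinearMap.ext fun v => by
    classical
    change f (A.P n⁻¹ (A.P m⁻¹ v)) = _
    rw [P_mul_apply]
    by_cases h : m = n
    · subst h; simp [dualP]
    · simp [h, Ne.symm h]
  P_sum := LinearMap.ext fun f => LinearMap.ext fun v => by
    rw [LinearMap.sum_apply, LinearMap.sum_apply]
    change ∑ m, f (A.P m⁻¹ v) = f v
    rw [← map_sum]
    exact congrArg f ((Equiv.sum_comp (Equiv.inv M) fun m => A.P m v).trans (P_sum_apply A v))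
  P_Q m g := LinearMap.ext fun f => LinearMap.ext fun v => by
    change f (A.Q g⁻¹ (A.P m⁻¹ v)) = f (A.P (X.act m g)⁻¹ (A.Q g⁻¹ v))
    rw [P_Q_apply, ← X.inv_act, ← X.act_mul, mul_inv_cancel, X.act_one]

theorem map_coevaluation {V : Type} [AddCommGroup V] [Module ℂ V] [FiniteDimensional ℂ V]
    (S T : V →ₗ[ℂ] V) :
    TensorProduct.map S T.dualMap (_root_.coevaluation ℂ V 1) =
      TensorProduct.map (S ∘ₗ T) LinearMap.id (_root_.coevaluation ℂ V 1) := by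
  let f : V ⊗[ℂ] Module.Dual ℂ V →ₗ[ℂ] (V →ₗ[ℂ] V) :=
    dualTensorHom ℂ V V ∘ₗ (TensorProduct.comm ℂ V (Module.Dual ℂ V)).toLinearMap
  have hf : Function.Injective f :=
    (dualTensorHomEquiv ℂ V V).injective.comp (TensorProduct.comm ℂ V _).injective
  have h1 : f (_root_.coevaluation ℂ V 1) = LinearMap.id := by
    rw [coevaluation_apply_one]
    ext v
    simp only [f, LinearMap.comp_apply, map_sum, LinearEquiv.coe_coe, TensorProduct.comm_tmul,
      LinearMap.sum_apply, dualTensorHom_apply, LinearMap.id_apply]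
    exact (Module.Basis.ofVectorSpace ℂ V).sum_repr v
  have h2 : ∀ (S T : V →ₗ[ℂ] V) x, f (TensorProduct.map S T.dualMap x) = S ∘ₗ f x ∘ₗ T := by
    intro S T x
    induction x with
    | zero => simp
    | tmul v φ => ext w; simp [f]
    | add x y hx hy => rw [map_add, map_add, hx, hy, map_add]; ext; simp
  apply hf
  have h3 := h2 (S ∘ₗ T) LinearMap.id (_root_.coevaluation ℂ V 1)
  rw [LinearMap.dualMap_id] at h3
  rw [h2, h3, h1]; rfl

/-- The coevaluation `1 ⟶ A ⊗ A*`, as for vector spaces. -/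
noncomputable def coev (A : Obj X) : Hom (trivial X) (tensor A (dual A)) where
  lin := _root_.coevaluation ℂ A.V
  comm_P m := LinearMap.congr_fun (f := _root_.coevaluation ℂ A.V ∘ₗ unitP m)
    (g := convP A.P (dualP A) m ∘ₗ _root_.coevaluation ℂ A.V) <| LinearMap.ext_ring <| by
    have : ∀ n : M, TensorProduct.map (A.P n) ((dualP A) (n⁻¹ * m))
        (_root_.coevaluation ℂ A.V 1) = TensorProduct.map (A.P n * A.P (n⁻¹ * m)⁻¹) LinearMap.id
        (_root_.coevaluation ℂ A.V 1) := fun n => map_coevaluation _ _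
    rw [LinearMap.comp_apply, LinearMap.comp_apply, convP, LinearMap.sum_apply]
    refine Eq.trans ?_ (Finset.sum_congr rfl fun n _ => (this n).symm)
    rw [unitP_apply]
    by_cases h : m = 1
    · subst h
      simp only [mul_one, inv_inv, A.P_mul, if_true]
      rw [← LinearMap.sum_apply]
      have : ∑ n, TensorProduct.map (A.P n) (LinearMap.id (R := ℂ) (M := Module.Dual ℂ A.V)) =
          LinearMap.id := by
        refine TensorProduct.ext' fun v f => ?_
        simp only [LinearMap.sum_apply, TensorProduct.map_tmul]
        rw [← TensorProduct.sum_tmul, P_sum_apply]; rfl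
      rw [this]; rfl
    · have h' : ∀ n : M, n ≠ (n⁻¹ * m)⁻¹ := fun n hn => h (by
        have : n = m⁻¹ * n := by rw [mul_inv_rev, inv_inv] at hn; exact hn
        simpa using this)
      rw [if_neg h, map_zero]
      refine (Finset.sum_eq_zero fun n _ => ?_).symm
      rw [A.P_mul, if_neg (h' n)]; simp
  comm_Q g := LinearMap.congr_fun (f := _root_.coevaluation ℂ A.V ∘ₗ (1 : ℂ →ₗ[ℂ] ℂ))
    (g := tensorQ A.Q (dualQ A) g ∘ₗ _root_.coevaluation ℂ A.V) <| LinearMap.ext_ring <| by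
    refine Eq.trans ?_ (map_coevaluation (A.Q g) (A.Q g⁻¹)).symm
    have : A.Q g ∘ₗ A.Q g⁻¹ = LinearMap.id := LinearMap.ext (A.Q_apply_inv g)
    rw [this, TensorProduct.map_id]; rfl

/-- The evaluation `A* ⊗ A ⟶ 1`, as for vector spaces. -/
noncomputable def eval (A : Obj X) : Hom (tensor (dual A) A) (trivial X) where
  lin := contractLeft ℂ A.V
  comm_P m := eq_of_tmul (contractLeft ℂ A.V ∘ₗ convP (dualP A) A.P m)
    (unitP m ∘ₗ contractLeft ℂ A.V) fun f v => by
    have e : ∀ n : M, contractLeft ℂ A.V ((dualP A) n f ⊗ₜ A.P (n⁻¹ * m) v) =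
        f (A.P n⁻¹ (A.P (n⁻¹ * m) v)) := fun n => rfl
    rw [LinearMap.comp_apply, LinearMap.comp_apply, convP_tmul, map_sum]
    refine (Finset.sum_congr rfl fun n _ => e n).trans ?_
    rw [unitP_apply, contractLeft_apply]
    by_cases h : m = 1
    · subst h
      simp only [mul_one, P_mul_apply, if_true]
      rw [← map_sum]
      exact congrArg f ((Equiv.sum_comp (Equiv.inv M) fun m => A.P m v).trans (P_sum_apply A v))
    · rw [if_neg h]
      refine Finset.sum_eq_zero fun n _ => ?_
      rw [P_mul_apply, if_neg (fun hn => h (by simpa using hn)), map_zero]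
  comm_Q g := eq_of_tmul (contractLeft ℂ A.V ∘ₗ tensorQ (dualQ A) A.Q g)
    ((1 : ℂ →ₗ[ℂ] ℂ) ∘ₗ contractLeft ℂ A.V) fun f v =>
    congrArg (f : A.V →ₗ[ℂ] ℂ) (A.Q_inv_apply g v)

noncomputable instance exactPairing (A : Obj X) : ExactPairing A (dual A) where
  coevaluation' := coev A
  evaluation' := eval A
  coevaluation_evaluation' := Hom.ext (contractLeft_assoc_coevaluation ℂ A.V)
  evaluation_coevaluation' := Hom.ext (contractLeft_assoc_coevaluation' ℂ A.V)

noncomputable instance rightDual (A : Obj X) : HasRightDual A := ⟨dual A⟩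

noncomputable instance rightRigidCategory : RightRigidCategory (Obj X) where

/-! The twist `∑ₘ Q(∂m) P(m)`, which is the scalar `ω` on an irreducible object. -/

/-- The operator `∑ₘ Q(∂m) P(m)`. -/
noncomputable def twistMap (A : Obj X) : A.V →ₗ[ℂ] A.V := ∑ m : M, A.Q (X.bd m) ∘ₗ A.P m

/-- The operator `∑ₘ Q(∂m)⁻¹ P(m)`. -/
noncomputable def twistInv (A : Obj X) : A.V →ₗ[ℂ] A.V := ∑ m : M, A.Q (X.bd m)⁻¹ ∘ₗ A.P m

theorem twistMap_apply (A : Obj X) (v : A.V) :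
    twistMap A v = ∑ m : M, A.Q (X.bd m) (A.P m v) := by
  simp [twistMap, LinearMap.sum_apply]

theorem twistInv_apply (A : Obj X) (v : A.V) :
    twistInv A v = ∑ m : M, A.Q (X.bd m)⁻¹ (A.P m v) := by
  simp [twistInv, LinearMap.sum_apply]

theorem twistMap_P (A : Obj X) (k : M) (v : A.V) :
    twistMap A (A.P k v) = A.Q (X.bd k) (A.P k v) := by
  rw [twistMap_apply]; exact sum_P_P A (fun m => A.Q (X.bd m)) k v

theorem twistInv_P (A : Obj X) (k : M) (v : A.V) :
    twistInv A (A.P k v) = A.Q (X.bd k)⁻¹ (A.P k v) := by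
  rw [twistInv_apply]; exact sum_P_P A (fun m => A.Q (X.bd m)⁻¹) k v

theorem twistInv_twistMap (A : Obj X) (v : A.V) : twistInv A (twistMap A v) = v := by
  have h : ∀ m : M, twistInv A (A.Q (X.bd m) (A.P m v)) = A.P m v := fun m => by
    have : A.Q (X.bd m) (A.P m v) = A.P m (A.Q (X.bd m) v) := by
      rw [P_Q_apply, X.act_bd, inv_mul_cancel, one_mul]
    rw [this, twistInv_P, ← this, Q_inv_apply]
  rw [twistMap_apply, map_sum]; simp only [h]; exact P_sum_apply A v

theorem twistMap_twistInv (A : Obj X) (v : A.V) : twistMap A (twistInv A v) = v := by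
  have h : ∀ m : M, twistMap A (A.Q (X.bd m)⁻¹ (A.P m v)) = A.P m v := fun m => by
    have : A.Q (X.bd m)⁻¹ (A.P m v) = A.P m (A.Q (X.bd m)⁻¹ v) := by
      rw [P_Q_apply, ← map_inv, X.act_bd]; congr 3; group
    rw [this, twistMap_P, ← this, Q_apply_inv]
  rw [twistInv_apply, map_sum]; simp only [h]; exact P_sum_apply A v

theorem P_twistMap (A : Obj X) (k : M) (v : A.V) :
    A.P k (twistMap A v) = A.Q (X.bd k) (A.P k v) := by
  classical
  rw [twistMap_apply, map_sum, Finset.sum_eq_single k]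
  · rw [P_Q_apply, X.act_bd, inv_mul_cancel, one_mul, P_mul_apply, if_pos rfl]
  · intro b _ hb
    rw [P_Q_apply, X.act_bd, P_mul_apply, if_neg, map_zero]
    intro h; apply hb
    have := congrArg (fun x => b * x * b⁻¹) h
    simpa [mul_assoc] using this.symm
  · simp

theorem twistMap_Q (A : Obj X) (g : G) (v : A.V) :
    twistMap A (A.Q g v) = A.Q g (twistMap A v) := by
  rw [twistMap_apply, twistMap_apply, map_sum,
    ← (X.actEquiv g).sum_comp fun m => A.Q g (A.Q (X.bd m) (A.P m v))]
  refine Finset.sum_congr rfl fun m _ => ?_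
  change _ = A.Q g (A.Q (X.bd (X.act m g)) (A.P (X.act m g) v))
  rw [P_Q_apply, ← Q_mul_apply, ← Q_mul_apply, X.bd_act]
  congr 2; group

/-- The twist of an object. -/
noncomputable def twist (A : Obj X) : A ≅ A :=
  isoMk (LinearEquiv.ofLinearMap (twistMap A) (twistInv A)
      (LinearMap.ext (twistMap_twistInv A)) (LinearMap.ext (twistInv_twistMap A)))
    (fun m v => (twistMap_P A m v).trans (P_twistMap A m v).symm) (twistMap_Q A)

theorem twist_tensor_aux (A B : Obj X) (v : A.V) (w : B.V) :
    ∑ k, tensorQ A.Q B.Q (X.bd k) (convP A.P B.P k (v ⊗ₜ w)) =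
      braidMap X B.P A.Q (braidMap X A.P B.Q (twistMap A v ⊗ₜ twistMap B w)) := by
  simp only [braidMap_tmul, convP_tmul, map_sum, tensorQ_tmul]
  rw [Finset.sum_comm]
  refine Finset.sum_congr rfl fun m _ => ?_
  rw [← Equiv.sum_comp (Equiv.mulRight m)]
  refine Finset.sum_congr rfl fun n _ => ?_
  rw [P_twistMap, P_Q_apply, P_twistMap, X.act_bd, ← Q_mul_apply, ← Q_mul_apply, ← map_mul,
    ← map_mul, Equiv.coe_mulRight]
  congr 3 <;> group

theorem twist_dual_aux (A : Obj X) (f : Module.Dual ℂ A.V) (v : A.V) :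
    (show Module.Dual ℂ A.V from twistMap (dual A) f) v = f (twistMap A v) := by
  have h : twistMap (dual A) f = ∑ m : M, dualQ A (X.bd m) (dualP A m f) :=
    twistMap_apply (dual A) f
  refine (LinearMap.congr_fun h v).trans ?_
  rw [LinearMap.sum_apply, twistMap_apply, map_sum, ← Equiv.sum_comp (Equiv.inv M)]
  refine Finset.sum_congr rfl fun m _ => ?_
  change f (A.P m⁻¹⁻¹ (A.Q (X.bd m⁻¹)⁻¹ v)) = _
  rw [P_Q_apply, ← map_inv, inv_inv, X.act_bd]
  congr 3; group

noncomputable instance ribbonCategory : RibbonCategory (Obj X) where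
  twist := twist
  twist_naturality {A B} f := hom_ext fun v => by
    change twistMap B (Hom.lin f v) = Hom.lin f (twistMap A v)
    simp [twistMap_apply, Hom.comm_P, Hom.comm_Q]
  twist_tensor A B := Hom.ext <| TensorProduct.ext' fun v w => by
    refine Eq.trans ?_ (twist_tensor_aux A B v w)
    exact twistMap_apply (tensor A B) (v ⊗ₜ w)
  twist_dual A := hom_ext fun f => LinearMap.ext fun v => by
    have h := congrArg (fun k => Hom.lin k ((f : Module.Dual ℂ A.V) ⊗ₜ[ℂ] v))
      (rightAdjointMate_comp_evaluation (twist A).hom)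
    refine Eq.trans ?_ h.symm
    exact twist_dual_aux A f v

/-! ### Irreducible objects, characters and the vacuum -/

/-- An object is irreducible if it is nonzero and has no nontrivial invariant subspace. -/
def IsIrreducible (A : Obj X) : Prop :=
  Nontrivial A.V ∧ ∀ W : Submodule ℂ A.V, (∀ m, ∀ v ∈ W, A.P m v ∈ W) →
    (∀ g, ∀ v ∈ W, A.Q g v ∈ W) → W = ⊥ ∨ W = ⊤

/-- `A` is a constituent of `B` if it is a direct summand of `B`. -/
def IsConstituent (A B : Obj X) : Prop := ∃ C : Obj X, Nonempty (B ≅ directSum A C)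

/-- The character `ψ(m, g) = Tr (P(m) Q(g))`. -/
noncomputable def character (A : Obj X) (m : M) (g : G) : ℂ :=
  LinearMap.trace ℂ A.V (A.P m * A.Q g)

theorem character_congr {A B : Obj X} (e : A ≅ B) : A.character = B.character := by
  funext m g
  rw [character, ← LinearMap.trace_conj' _ (isoLin e)]
  congr 1
  refine LinearMap.ext fun v => ?_
  rw [LinearEquiv.conj_apply_apply]
  obtain ⟨v, rfl⟩ := (isoLin e).surjective v
  rw [LinearEquiv.symm_apply_apply, Module.End.mul_apply, isoLin_P, isoLin_Q]
  rfl

end Obj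

/-- The set of isomorphism classes of irreducible objects. -/
def Irr (X : CrossedModule G M) : Type 1 :=
  Quotient ((isIsomorphicSetoid (Obj X)).comap
    (Subtype.val : {A : Obj X // A.IsIrreducible} → Obj X))

/-- The irreducible character `ψ_p`. -/
noncomputable def Irr.character (p : Irr X) : M → G → ℂ :=
  Quotient.lift (fun A : {A : Obj X // A.IsIrreducible} => A.1.character)
    (fun A B (h : Nonempty (A.1 ≅ B.1)) => h.elim Obj.character_congr) p

/-- The matrix `S_{pq} = |𝓧|⁻¹ ∑_{m,n} conj (ψ_p(m, ∂n) ψ_q(n, ∂m))`, with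
`|𝓧| = |M| |coker ∂|`. -/
noncomputable def sMatrix (X : CrossedModule G M) : Matrix (Irr X) (Irr X) ℂ :=
  Matrix.of fun p q => (1 / ((Nat.card M : ℂ) * (Nat.card X.Coker : ℂ))) *
    ∑ m : M, ∑ n : M, conj (p.character m (X.bd n) * q.character n (X.bd m))

/-- The operators `(P(m) φ)(x, I y) = δ(m, x ^ y) φ(x, I y)` on functions on
`ker ∂ × coker ∂`. -/
noncomputable def vacuumP (X : CrossedModule G M) (m : M) :
    (X.bd.ker × X.Coker → ℂ) →ₗ[ℂ] (X.bd.ker × X.Coker → ℂ) where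
  toFun φ z := open Classical in if m = X.kerAct z.1 z.2 then φ z else 0
  map_add' φ χ := funext fun z => by simp only [Pi.add_apply]; split_ifs <;> simp
  map_smul' r φ := funext fun z => by simp

/-- The operators `(Q(g) φ)(x, I y) = φ(x, I y g)` on functions on `ker ∂ × coker ∂`. -/
def vacuumQ (X : CrossedModule G M) :
    G →* ((X.bd.ker × X.Coker → ℂ) →ₗ[ℂ] (X.bd.ker × X.Coker → ℂ)) where
  toFun g := LinearMap.funLeft ℂ ℂ fun z => (z.1, z.2 * (g : X.Coker))
  map_one' := LinearMap.ext fun φ => funext fun z => by simp [LinearMap.funLeft_apply]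
  map_mul' g h := LinearMap.ext fun φ => funext fun z => by
    simp [LinearMap.funLeft_apply, mul_assoc]

/-- The vacuum object. -/
noncomputable def vacuum [Finite G] (X : CrossedModule G M) : Obj X where
  V := X.bd.ker × X.Coker → ℂ
  P := X.vacuumP
  Q := X.vacuumQ
  P_mul m n := LinearMap.ext fun φ => funext fun z => by
    classical
    change (if m = X.kerAct z.1 z.2 then if n = X.kerAct z.1 z.2 then φ z else 0 else 0) = _
    by_cases h : m = n
    · subst h
      rw [if_pos rfl]
      change _ = if m = X.kerAct z.1 z.2 then φ z else 0
      split_ifs <;> rfl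
    · rw [if_neg h]
      split_ifs with h1 h2
      · exact absurd (h1.trans h2.symm) h
      · rfl
      · rfl
  P_sum := LinearMap.ext fun φ => funext fun z => by
    rw [LinearMap.sum_apply, Finset.sum_apply, Finset.sum_eq_single (X.kerAct z.1 z.2)]
    · exact if_pos rfl
    · intro b _ hb; exact if_neg hb
    · simp
  P_Q m g := LinearMap.ext fun φ => funext fun z => by
    have h : m = X.kerAct z.1 z.2 ↔ X.act m g = X.kerAct z.1 (z.2 * (g : X.Coker)) := by
      rw [X.kerAct_mul]; exact (X.actEquiv g).injective.eq_iff.symm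
    classical
    change (if m = X.kerAct z.1 z.2 then φ (z.1, z.2 * (g : X.Coker)) else 0) =
      if X.act m g = X.kerAct z.1 (z.2 * (g : X.Coker)) then φ (z.1, z.2 * (g : X.Coker)) else 0
    split_ifs <;> tauto

end CrossedModule

namespace CrossedModule

namespace Obj

variable {G M : Type} [Group G] [Group M] [Fintype M] {X : CrossedModule G M}

/-! The objects are the finite-dimensional modules over a finite-dimensional algebra spanned by the
products `P(m) Q(g)`. Averaging a linear map over `m` and `g` produces a morphism, and this gives
Maschke's theorem (`exists_directSum_iso`). With Schur's lemma it also gives orthogonality of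
characters: the trace of the averaging operator on `Hom(A, B)` is the character pairing. Irreducible
characters are therefore linearly independent functions on `M × G`, so there are finitely many. They
are also complete: a class function orthogonal to all of them acts by zero on every object, in
particular on the faithful regular one, and so vanishes.

Everything else concerns the matrix `B_{pq} = ∑ ψ_p(m, ∂n) ψ_q(n, ∂m)` (`braidingMatrix`). The
matrix `S` is a nonzero multiple of its complex conjugate. The quantum trace is the ordinary trace,
because the twist in its definition cancels the inverse twist produced by the braiding; so `B` is
also the matrix of traces of double braidings. All other axioms of modularity hold for every finite
crossed module, whence 1 ⇔ 2.

If `B` is invertible, the identity object is the only irreducible constituent of the vacuum. Indeed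
such a constituent has `P` supported on `ker ∂` and `Q` trivial on `im ∂`, so its row of `B` is its
dimension times the row of the identity object. If only the identity object occurs, then `G` and `M`
act on the functions on `K × C` as on a multiple of the identity object, which forces `K` and `C` to
be trivial. Conversely, let `∂` be bijective and `B c = 0`. Then `f(m, g) = ∑ c_q ψ_q(∂⁻¹g, ∂m)` is
a class function orthogonal to all irreducible characters; completeness gives `f = 0` and
independence gives `c = 0`. -/

theorem P_P_self (A : Obj X) (m : M) (v : A.V) : A.P m (A.P m v) = A.P m v := by
  rw [P_mul_apply, if_pos rfl]

/-! ### Subobjects -/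

/-- A subspace is invariant if it is stable under all `P m` and `Q g`. -/
structure IsInvariant (A : Obj X) (W : Submodule ℂ A.V) : Prop where
  P_mem : ∀ m, ∀ v ∈ W, A.P m v ∈ W
  Q_mem : ∀ g, ∀ v ∈ W, A.Q g v ∈ W

/-- The object formed by an invariant subspace. -/
def sub (A : Obj X) (W : Submodule ℂ A.V) (hW : A.IsInvariant W) : Obj X where
  V := W
  P m := (A.P m).restrict (hW.P_mem m)
  Q := { toFun := fun g => (A.Q g).restrict (hW.Q_mem g)
         map_one' := LinearMap.ext fun v => Subtype.ext (A.Q_one_apply v)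
         map_mul' := fun g h => LinearMap.ext fun v => Subtype.ext (A.Q_mul_apply g h v) }
  P_mul m n := LinearMap.ext fun v => Subtype.ext <| by
    change A.P m (A.P n v) = _
    rw [P_mul_apply]
    split_ifs <;> rfl
  P_sum := LinearMap.ext fun v => Subtype.ext <| by
    rw [LinearMap.sum_apply, Submodule.coe_sum]
    exact A.P_sum_apply v
  P_Q m g := LinearMap.ext fun v => Subtype.ext (A.P_Q_apply m g v)

/-- The inclusion of an invariant subspace. -/
def incl (A : Obj X) (W : Submodule ℂ A.V) (hW : A.IsInvariant W) : A.sub W hW ⟶ A :=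
  (⟨W.subtype, fun _ _ => rfl, fun _ _ => rfl⟩ : Hom (A.sub W hW) A)

theorem isInvariant_ker {A B : Obj X} (f : A ⟶ B) :
    A.IsInvariant (LinearMap.ker (Hom.lin f)) where
  P_mem m v hv := by
    rw [LinearMap.mem_ker] at hv ⊢
    rw [Hom.comm_P, hv, map_zero]
  Q_mem m v hv := by
    rw [LinearMap.mem_ker] at hv ⊢
    rw [Hom.comm_Q, hv, map_zero]

theorem isInvariant_range {A B : Obj X} (f : A ⟶ B) :
    B.IsInvariant (LinearMap.range (Hom.lin f)) where
  P_mem := by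
    rintro m _ ⟨v, rfl⟩
    exact ⟨A.P m v, Hom.comm_P f m v⟩
  Q_mem := by
    rintro g _ ⟨v, rfl⟩
    exact ⟨A.Q g v, Hom.comm_Q f g v⟩

/-- A bijective morphism is an isomorphism. -/
noncomputable def isoOfBijective {A B : Obj X} (f : A ⟶ B)
    (hf : Function.Bijective (Hom.lin f)) : A ≅ B :=
  isoMk (LinearEquiv.ofBijective (Hom.lin f) hf) (Hom.comm_P f) (Hom.comm_Q f)

theorem isIso_of_bijective {A B : Obj X} (f : A ⟶ B)
    (hf : Function.Bijective (Hom.lin f)) : IsIso f := by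
  have h : (isoOfBijective f hf).hom = f := hom_ext fun _ => rfl
  rw [← h]
  infer_instance

/-- The kernel of a morphism is itself an object, and a monomorphism cancels the inclusion of its
own kernel. -/
theorem mono_iff_injective {A B : Obj X} (f : A ⟶ B) :
    Mono f ↔ Function.Injective (Hom.lin f) := by
  refine ⟨fun hf => ?_, fun hf => ⟨fun g h hgh => hom_ext fun v => hf ?_⟩⟩
  · rw [← LinearMap.ker_eq_bot, Submodule.eq_bot_iff]
    intro v hv
    have h0 : A.incl _ (isInvariant_ker f) = 0 := by
      rw [← cancel_mono f, Limits.zero_comp]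
      exact hom_ext fun w => (w : LinearMap.ker (Hom.lin f)).2
    exact LinearMap.congr_fun (congrArg Hom.lin h0) ⟨v, hv⟩
  · exact LinearMap.congr_fun (congrArg Hom.lin hgh) v

/-! ### Schur's lemma -/

/-- A nonzero morphism between irreducible objects is bijective. -/
theorem IsIrreducible.bijective {A B : Obj X} (hA : A.IsIrreducible) (hB : B.IsIrreducible)
    {f : A ⟶ B} (hf : f ≠ 0) : Function.Bijective (Hom.lin f) := by
  have hk := isInvariant_ker f
  have hr := isInvariant_range f
  have hf' : Hom.lin f ≠ 0 := fun h => hf (Hom.ext h)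
  constructor
  · rw [← LinearMap.ker_eq_bot]
    refine (hA.2 _ hk.1 hk.2).resolve_right fun h => hf' ?_
    exact LinearMap.ker_eq_top.mp h
  · rw [← LinearMap.range_eq_top]
    refine (hB.2 _ hr.1 hr.2).resolve_left fun h => hf' ?_
    exact LinearMap.range_eq_bot.mp h

/-- Over `ℂ` the morphism has an eigenvalue `c`; subtracting `c` destroys injectivity, so the
difference must be zero. -/
theorem IsIrreducible.exists_smul_id {A : Obj X} (hA : A.IsIrreducible) (f : A ⟶ A) :
    ∃ c : ℂ, Hom.lin f = c • LinearMap.id := by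
  have := hA.1
  obtain ⟨c, hc⟩ := Module.End.exists_eigenvalue (Hom.lin f)
  refine ⟨c, ?_⟩
  by_contra h
  have h0 : f - c • 𝟙 A ≠ 0 := fun h0 => h (congrArg Hom.lin (sub_eq_zero (a := f).mp h0))
  obtain ⟨v, hv⟩ := hc.exists_hasEigenvector
  refine hv.2 ((hA.bijective hA h0).1 (Eq.trans ?_ (map_zero _).symm))
  have h1 : Hom.lin (f - c • 𝟙 A) = Hom.lin f - c • LinearMap.id := by
    rw [eq_sub_iff_add_eq]
    exact congrArg Hom.lin (sub_add_cancel f (c • 𝟙 A))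
  rw [h1, LinearMap.sub_apply, hv.apply_eq_smul, LinearMap.smul_apply, LinearMap.id_apply,
    sub_self]

theorem IsIrreducible.of_iso {A B : Obj X} (e : A ≅ B) (hA : A.IsIrreducible) :
    B.IsIrreducible := by
  have := hA.1
  refine ⟨(isoLin e).symm.toEquiv.nontrivial, fun W hP hQ => ?_⟩
  have h := hA.2 (W.comap (isoLin e).toLinearMap)
    (fun m v hv => by
      rw [Submodule.mem_comap, LinearEquiv.coe_coe] at hv ⊢
      rw [isoLin_P]; exact hP m _ hv)
    (fun g v hv => by
      rw [Submodule.mem_comap, LinearEquiv.coe_coe] at hv ⊢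
      rw [isoLin_Q]; exact hQ g _ hv)
  refine h.imp (fun h => ?_) (fun h => ?_)
  · rw [Submodule.eq_bot_iff] at h ⊢
    intro w hw
    obtain ⟨v, rfl⟩ := (isoLin e).surjective w
    rw [h v hw, map_zero]
  · rw [Submodule.eq_top_iff'] at h ⊢
    intro w
    obtain ⟨v, rfl⟩ := (isoLin e).surjective w
    exact h v

/-- `Simple` tests monomorphisms. These are the injective morphisms, so up to isomorphism they are
the inclusions of invariant subspaces. -/
theorem simple_iff_isIrreducible (A : Obj X) : Simple A ↔ A.IsIrreducible := by
  constructor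
  · intro hA
    refine ⟨?_, fun W hP hQ => ?_⟩
    · by_contra h
      rw [not_nontrivial_iff_subsingleton] at h
      exact id_nonzero A (hom_ext fun v => Subsingleton.elim _ _)
    · have hW : A.IsInvariant W := ⟨hP, hQ⟩
      have : Mono (A.incl W hW) := (mono_iff_injective _).mpr Subtype.val_injective
      by_cases h : A.incl W hW = 0
      · left
        rw [Submodule.eq_bot_iff]
        exact fun v hv => LinearMap.congr_fun (congrArg Hom.lin h) ⟨v, hv⟩
      · right
        have := (Simple.mono_isIso_iff_nonzero (A.incl W hW)).mpr h
        rw [Submodule.eq_top_iff']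
        intro v
        obtain ⟨w, rfl⟩ := (isoLin (asIso (A.incl W hW))).surjective v
        exact w.2
  · intro hA
    have := hA.1
    refine ⟨fun {Y} f hf => ⟨fun h h0 => ?_, fun h0 => isIso_of_bijective f ⟨?_, ?_⟩⟩⟩
    · obtain ⟨v, hv⟩ := exists_ne (0 : A.V)
      obtain ⟨w, rfl⟩ := (isoLin (asIso f)).surjective v
      exact hv (LinearMap.congr_fun (congrArg Hom.lin h0) w)
    · exact (mono_iff_injective f).mp hf
    · have hr := isInvariant_range f
      rw [← LinearMap.range_eq_top]
      refine (hA.2 _ hr.1 hr.2).resolve_left fun h => h0 (Hom.ext ?_)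
      exact LinearMap.range_eq_bot.mp h

/-! ### Averaging and complete reducibility -/

section average

variable [Fintype G]

/-- The average `f ↦ ∑ₘ ∑_g P(m) Q(g) f Q(g)⁻¹ P(m)` of linear maps. -/
noncomputable def average (A B : Obj X) : (A.V →ₗ[ℂ] B.V) →ₗ[ℂ] (A.V →ₗ[ℂ] B.V) :=
  ∑ m : M, ∑ g : G, LinearMap.lcomp ℂ B.V (A.Q g⁻¹ * A.P m) ∘ₗ
    LinearMap.llcomp ℂ A.V B.V B.V (B.P m * B.Q g)

theorem average_apply (A B : Obj X) (f : A.V →ₗ[ℂ] B.V) (v : A.V) :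
    average A B f v = ∑ m : M, ∑ g : G, B.P m (B.Q g (f (A.Q g⁻¹ (A.P m v)))) := by
  simp [average, LinearMap.sum_apply]

/-- The average of a linear map is a morphism. -/
noncomputable def averageHom (A B : Obj X) (f : A.V →ₗ[ℂ] B.V) : A ⟶ B :=
  ({ lin := average A B f
     comm_P := fun k v => by
      classical
      -- Orthogonality of the projections leaves only the term `m = k` on both sides.
      rw [average_apply, average_apply, map_sum,
        Finset.sum_eq_single k (fun m _ hm => Finset.sum_eq_zero fun g _ => by
          rw [P_mul_apply, if_neg hm]; simp) (by simp),
        Finset.sum_eq_single k (fun m _ hm => by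
          rw [map_sum]
          exact Finset.sum_eq_zero fun g _ => by rw [P_mul_apply, if_neg (Ne.symm hm)])
          (by simp)]
      rw [map_sum]
      exact Finset.sum_congr rfl fun g _ => by rw [P_P_self, P_P_self]
     comm_Q := fun h v => by
      rw [average_apply, average_apply, map_sum]
      -- The operator `Q(h)` is absorbed by substituting `m ^ h` for `m` on one side and `h * g` for
      -- `g` on the other.
      refine Eq.trans ?_ ((X.actEquiv h).sum_comp fun m => B.Q h
        (∑ g : G, B.P m (B.Q g (f (A.Q g⁻¹ (A.P m v))))))
      refine Finset.sum_congr rfl fun m _ => ?_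
      rw [map_sum, ← Equiv.sum_comp (Equiv.mulLeft h)]
      refine Finset.sum_congr rfl fun g _ => ?_
      change _ = B.Q h (B.P (X.act m h) _)
      rw [← P_Q_apply, ← Q_mul_apply, P_Q_apply A, ← Q_mul_apply, Equiv.coe_mulLeft,
        mul_inv_rev, inv_mul_cancel_right]
      rfl } : Hom A B)

/-- Since `i` is a morphism, each term equals `P(m) w`. The sum over `m` is a partition of unity, so
only the sum over `g` contributes a factor, namely `|G|`. -/
theorem average_retraction {A B : Obj X} (i : B ⟶ A) (f : A.V →ₗ[ℂ] B.V)
    (hf : ∀ w, f (Hom.lin i w) = w) (w : B.V) :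
    average A B f (Hom.lin i w) = (Fintype.card G : ℂ) • w := by
  rw [average_apply]
  have h : ∀ (m : M) (g : G), B.P m (B.Q g (f (A.Q g⁻¹ (A.P m (Hom.lin i w))))) = B.P m w :=
    fun m g => by rw [← Hom.comm_P, ← Hom.comm_Q, hf, Q_apply_inv, P_P_self]
  simp only [h, Finset.sum_const, Finset.card_univ, ← Finset.smul_sum]
  rw [P_sum_apply, Nat.cast_smul_eq_nsmul]

/-- An injective morphism is the inclusion of a direct summand (Maschke's theorem). -/
theorem exists_directSum_iso {A B : Obj X} (i : B ⟶ A) (hi : Function.Injective (Hom.lin i)) :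
    ∃ C : Obj X, Nonempty (directSum B C ≅ A) := by
  obtain ⟨f, hf⟩ := (Hom.lin i).exists_leftInverse_of_injective (LinearMap.ker_eq_bot.mpr hi)
  have h := average_retraction i f (LinearMap.congr_fun hf)
  have hcard : (Fintype.card G : ℂ) ≠ 0 := Nat.cast_ne_zero.mpr Fintype.card_ne_zero
  -- The complement is the kernel of the averaged retraction.
  have hk := isInvariant_ker (averageHom A B f)
  let F : Hom (directSum B (A.sub _ hk)) A :=
    { lin := (Hom.lin i).coprod (Hom.lin (A.incl _ hk))
      comm_P := fun m v => (congrArg₂ (· + ·) (Hom.comm_P i m v.1)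
        (Hom.comm_P (A.incl _ hk) m v.2)).trans (map_add (A.P m) _ _).symm
      comm_Q := fun m v => (congrArg₂ (· + ·) (Hom.comm_Q i m v.1)
        (Hom.comm_Q (A.incl _ hk) m v.2)).trans (map_add (A.Q m) _ _).symm }
  refine ⟨_, ⟨isoOfBijective (A := directSum B (A.sub _ hk)) (B := A) F ⟨?_, ?_⟩⟩⟩
  · refine LinearMap.ker_eq_bot.mp ((Submodule.eq_bot_iff _).mpr ?_)
    rintro ⟨w, k, hk'⟩ hwk
    have hwk' : Hom.lin i w + k = 0 := hwk
    have h1 : average A B f (Hom.lin i w + k) = 0 := by rw [hwk', map_zero]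
    have h2 : average A B f k = 0 := hk'
    rw [map_add, h, h2, add_zero] at h1
    have hw : w = 0 := (smul_eq_zero.mp h1).resolve_left hcard
    subst hw
    rw [map_zero, zero_add] at hwk'
    subst hwk'
    rfl
  · intro v
    -- Dividing by `|G|` turns the average into a true retraction, which gives the `B`-component of
    -- `v`.
    let w : B.V := (Fintype.card G : ℂ)⁻¹ • average A B f v
    have hv : average A B f (v - Hom.lin i w) = 0 := by
      rw [map_sub, h, smul_inv_smul₀ hcard, sub_self]
    exact ⟨(w, ⟨v - Hom.lin i w, hv⟩), add_sub_cancel (Hom.lin i w) v⟩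

/-- A property of objects that is stable under isomorphisms and direct sums holds for all objects
if it holds for the irreducible objects and for zero objects. -/
theorem induction_directSum {motive : Obj X → Prop}
    (iso : ∀ {A B : Obj X}, (A ≅ B) → motive A → motive B)
    (zero : ∀ A : Obj X, Subsingleton A.V → motive A)
    (irreducible : ∀ A : Obj X, A.IsIrreducible → motive A)
    (directSum : ∀ A B : Obj X, motive A → motive B → motive (directSum A B)) (A : Obj X) :
    motive A := by
  induction h : Module.finrank ℂ A.V using Nat.strong_induction_on generalizing A with
  -- A reducible nonzero object splits along a proper nonzero invariant subspace, and both summands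
  -- have smaller dimension.
  | _ n ih =>
    subst h
    by_cases hA : A.IsIrreducible
    · exact irreducible A hA
    · rcases subsingleton_or_nontrivial A.V with h0 | h0
      · exact zero A h0
      · simp only [IsIrreducible, h0, true_and, not_forall, not_or] at hA
        obtain ⟨W, hP, hQ, hbot, htop⟩ := hA
        obtain ⟨C, ⟨e⟩⟩ := exists_directSum_iso (A.incl W ⟨hP, hQ⟩) Subtype.val_injective
        have hlt := Submodule.finrank_lt htop
        have hpos : 0 < Module.finrank ℂ W :=
          Module.finrank_pos_iff.mpr (Submodule.nontrivial_iff_ne_bot.mpr hbot)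
        have hsum : Module.finrank ℂ W + Module.finrank ℂ C.V = Module.finrank ℂ A.V :=
          (Module.finrank_prod (R := ℂ) (M := W) (M' := C.V)).symm.trans (isoLin e).finrank_eq
        exact iso e (directSum _ _ (ih _ hlt _ rfl) (ih _ (by omega) _ rfl))

end average

end Obj

end CrossedModule

/-! ### Traces on spaces of linear maps -/

theorem LinearMap.trace_conj_of_basis {R V W ι : Type*} [CommSemiring R] [AddCommMonoid V]
    [Module R V] [AddCommMonoid W] [Module R W] [Finite ι] (b : Module.Basis ι R V)
    (e : V ≃ₗ[R] W) (f : V →ₗ[R] V) :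
    LinearMap.trace R W (e.conj f) = LinearMap.trace R V f := by
  classical
  cases nonempty_fintype ι
  rw [LinearMap.trace_eq_matrix_trace R (b.map e), LinearMap.trace_eq_matrix_trace R b]
  congr 1
  ext i j
  simp [LinearMap.toMatrix_apply]

/-- The trace of `f ↦ b ∘ f ∘ a` on a space of linear maps. -/
theorem LinearMap.trace_llcomp_lcomp {K V W : Type*} [Field K] [AddCommGroup V] [Module K V]
    [AddCommGroup W] [Module K W] [FiniteDimensional K V] [FiniteDimensional K W]
    (a : V →ₗ[K] V) (b : W →ₗ[K] W) :
    LinearMap.trace K (V →ₗ[K] W) (LinearMap.lcomp K W a ∘ₗ LinearMap.llcomp K V W W b) =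
      LinearMap.trace K V a * LinearMap.trace K W b := by
  -- Under `V* ⊗ W ≃ Hom(V, W)` the operator becomes `aᵗ ⊗ b`, whose trace is a product.
  have h : LinearMap.lcomp K W a ∘ₗ LinearMap.llcomp K V W W b =
      (dualTensorHomEquiv K V W).conj (TensorProduct.map a.dualMap b) := by
    refine LinearMap.ext fun f => ?_
    obtain ⟨x, rfl⟩ := (dualTensorHomEquiv K V W).surjective f
    rw [LinearEquiv.conj_apply_apply, LinearEquiv.symm_apply_apply]
    induction x with
    | zero => simp
    | tmul φ w =>
      refine LinearMap.ext fun v => ?_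
      simp
    | add x y hx hy => simp only [map_add, hx, hy]
  rw [h, LinearMap.trace_conj_of_basis ((Module.finBasis K (Module.Dual K V)).tensorProduct
    (Module.finBasis K W)), LinearMap.trace_tensorProduct']
  congr 1
  exact LinearMap.trace_transpose' a

namespace CrossedModule

variable {G M : Type} [Group G] [Group M] [Fintype M] {X : CrossedModule G M}

namespace Obj

/-! ### Semisimplicity -/

/-- Every object is a finite biproduct of simple objects. -/
theorem exists_iso_biproduct_simple [Finite G] (A : Obj X) :
    ∃ (n : ℕ) (V : Fin n → Obj X), (∀ i, Simple (V i)) ∧ Nonempty (A ≅ ⨁ V) := by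
  cases nonempty_fintype G
  -- With arbitrary finite index types a direct sum is indexed by a disjoint union; `Fin n` is
  -- recovered by reindexing.
  suffices h : ∃ (ι : Type) (_ : Fintype ι) (V : ι → Obj X),
      (∀ i, Simple (V i)) ∧ Nonempty (A ≅ ⨁ V) by
    obtain ⟨ι, _, V, hV, ⟨e⟩⟩ := h
    exact ⟨Fintype.card ι, V ∘ (Fintype.equivFin ι).symm, fun i => hV _,
      ⟨e ≪≫ (Limits.biproduct.whiskerEquiv (Fintype.equivFin ι).symm fun _ => Iso.refl _).symm⟩⟩
  induction A using induction_directSum with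
  | iso e h =>
    obtain ⟨ι, _, V, hV, ⟨e'⟩⟩ := h
    exact ⟨ι, inferInstance, V, hV, ⟨e.symm ≪≫ e'⟩⟩
  | zero A h =>
    refine ⟨Empty, inferInstance, Empty.elim, fun i => i.elim, ⟨Limits.IsZero.iso ?_ ?_⟩⟩
    · exact (Limits.IsZero.iff_id_eq_zero _).mpr (hom_ext fun _ => Subsingleton.elim _ _)
    · exact (Limits.IsZero.iff_id_eq_zero _).mpr (Limits.biproduct.hom_ext _ _ fun i => i.elim)
  | irreducible A h =>
    exact ⟨Unit, inferInstance, fun _ => A, fun _ => (simple_iff_isIrreducible A).mpr h,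
      ⟨(Limits.biproductUniqueIso fun _ : Unit => A).symm⟩⟩
  | directSum A B hA hB =>
    obtain ⟨ι, _, V, hV, ⟨e⟩⟩ := hA
    obtain ⟨κ, _, W, hW, ⟨e'⟩⟩ := hB
    have e1 : directSum A B ≅ A ⊞ B :=
      Limits.biprod.uniqueUpToIso A B (b := directSumBicone A B)
        (Limits.isBinaryBilimitOfTotal _ (hom_ext fun v =>
          Prod.ext (add_zero (v : A.V × B.V).1) (zero_add (v : A.V × B.V).2)))
    -- The binary biproduct of the two biproducts is a biproduct of the combined family.
    let b : Limits.Bicone (Sum.elim V W) :=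
      { pt := (⨁ V) ⊞ (⨁ W)
        π := fun | .inl i => Limits.biprod.fst ≫ Limits.biproduct.π V i
                 | .inr j => Limits.biprod.snd ≫ Limits.biproduct.π W j
        ι := fun | .inl i => Limits.biproduct.ι V i ≫ Limits.biprod.inl
                 | .inr j => Limits.biproduct.ι W j ≫ Limits.biprod.inr
        ι_π := by
          classical
          rintro (i | i) (j | j)
          · by_cases h : i = j
            · subst h; simp; rfl
            · simp [h, Limits.biproduct.ι_π_ne _ h]; rfl
          · simp; rfl
          · simp; rfl
          · by_cases h : i = j
            · subst h; simp; rfl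
            · simp [h, Limits.biproduct.ι_π_ne _ h]; rfl }
    have hb : b.IsBilimit := Limits.isBilimitOfTotal b <| by
      rw [Fintype.sum_sum_type]
      have h1 : ∑ i, b.π (Sum.inl i) ≫ b.ι (Sum.inl i) =
          Limits.biprod.fst ≫ (∑ i, Limits.biproduct.π V i ≫ Limits.biproduct.ι V i) ≫
            Limits.biprod.inl := by
        rw [Preadditive.sum_comp, Preadditive.comp_sum]
        refine Finset.sum_congr rfl fun i _ => ?_
        change (Limits.biprod.fst ≫ Limits.biproduct.π V i) ≫
          Limits.biproduct.ι V i ≫ Limits.biprod.inl = _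
        simp only [Category.assoc]
      have h2 : ∑ i, b.π (Sum.inr i) ≫ b.ι (Sum.inr i) =
          Limits.biprod.snd ≫ (∑ i, Limits.biproduct.π W i ≫ Limits.biproduct.ι W i) ≫
            Limits.biprod.inr := by
        rw [Preadditive.sum_comp, Preadditive.comp_sum]
        refine Finset.sum_congr rfl fun i _ => ?_
        change (Limits.biprod.snd ≫ Limits.biproduct.π W i) ≫
          Limits.biproduct.ι W i ≫ Limits.biprod.inr = _
        simp only [Category.assoc]
      rw [h1, h2, Limits.biproduct.total, Limits.biproduct.total, Category.id_comp,
        Category.id_comp]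
      exact Limits.biprod.total
    refine ⟨ι ⊕ κ, inferInstance, Sum.elim V W, ?_,
      ⟨e1 ≪≫ Limits.biprod.mapIso e e' ≪≫ Limits.biproduct.uniqueUpToIso _ hb⟩⟩
    rintro (i | j)
    exacts [hV i, hW j]

/-! ### Orthogonality of characters -/

theorem IsIrreducible.finrank_ne_zero {A : Obj X} (hA : A.IsIrreducible) :
    (Module.finrank ℂ A.V : ℂ) ≠ 0 := by
  have := hA.1
  exact Nat.cast_ne_zero.mpr Module.finrank_pos.ne'

section orthogonality

variable [Fintype G]

/-- One side of the orthogonality relations; Schur's lemma evaluates the other side. -/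
theorem trace_average (A B : Obj X) :
    LinearMap.trace ℂ (A.V →ₗ[ℂ] B.V) (average A B) =
      ∑ m : M, ∑ g : G, A.character m g⁻¹ * B.character m g := by
  simp only [average, map_sum, LinearMap.trace_llcomp_lcomp, character]
  simp only [LinearMap.trace_mul_comm ℂ (A.Q _)]

/-- Cyclicity moves `P(m) Q(g)` behind `Q(g⁻¹) P(m)`. The sum over `m` then collapses to `f`, with
one copy for each `g`. -/
theorem trace_average_apply (A : Obj X) (f : A.V →ₗ[ℂ] A.V) :
    LinearMap.trace ℂ A.V (average A A f) = Fintype.card G * LinearMap.trace ℂ A.V f := by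
  have h : average A A f = ∑ g : G, ∑ m : M, (A.P m * A.Q g) * (f * (A.Q g⁻¹ * A.P m)) := by
    rw [Finset.sum_comm]
    refine LinearMap.ext fun v => ?_
    rw [average_apply]
    simp [LinearMap.sum_apply]
  have h' : ∀ g : G, ∑ m : M, f * (A.Q g⁻¹ * A.P m) * (A.P m * A.Q g) = f := fun g => by
    have : ∀ m : M, f * (A.Q g⁻¹ * A.P m) * (A.P m * A.Q g) = f * A.Q g⁻¹ * A.P m * A.Q g :=
      fun m => LinearMap.ext fun v => by simp [P_P_self]
    simp only [this]
    rw [← Finset.sum_mul, ← Finset.mul_sum, A.P_sum, mul_one, mul_assoc, ← map_mul,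
      inv_mul_cancel, map_one, mul_one]
  rw [h, map_sum]
  simp only [map_sum]
  simp only [LinearMap.trace_mul_comm ℂ (A.P _ * A.Q _)]
  simp only [← map_sum, h', Finset.sum_const, Finset.card_univ]
  rw [map_nsmul, nsmul_eq_mul]

theorem IsIrreducible.trace_average_eq_zero {A B : Obj X} (hA : A.IsIrreducible)
    (hB : B.IsIrreducible) (h : IsEmpty (A ≅ B)) :
    LinearMap.trace ℂ (A.V →ₗ[ℂ] B.V) (average A B) = 0 := by
  have h0 : average A B = 0 := LinearMap.ext fun f => by
    by_contra hf
    have hf' : averageHom A B f ≠ 0 := fun h => hf (congrArg Hom.lin h)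
    exact h.false (isoOfBijective _ (hA.bijective hB hf'))
  rw [h0, map_zero]

/-- By Schur's lemma each average is a scalar, and its trace determines that scalar as `|G| tr f /
dim A`. So averaging is a rank-one operator whose trace can be read off. -/
theorem IsIrreducible.trace_average_self {A : Obj X} (hA : A.IsIrreducible) :
    LinearMap.trace ℂ (A.V →ₗ[ℂ] A.V) (average A A) = Fintype.card G := by
  have hd := hA.finrank_ne_zero
  have h : average A A = (LinearMap.trace ℂ A.V).smulRight
      (((Fintype.card G : ℂ) / Module.finrank ℂ A.V) • LinearMap.id) := LinearMap.ext fun f => by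
    obtain ⟨c, hc⟩ := hA.exists_smul_id (averageHom A A f)
    have hc' : average A A f = c • LinearMap.id := hc
    have ht := trace_average_apply A f
    rw [hc', map_smul, LinearMap.trace_id, smul_eq_mul] at ht
    rw [hc', LinearMap.smulRight_apply, smul_smul]
    congr 1
    field_simp
    rw [ht, mul_comm]
  rw [h, LinearMap.trace_smulRight, map_smul, LinearMap.trace_id, smul_eq_mul,
    div_mul_cancel₀ _ hd]

end orthogonality

end Obj

/-! ### Independence of the irreducible characters and finiteness of `Irr` -/

namespace Irr

/-- An irreducible object representing a class. -/
noncomputable def rep (p : Irr X) : Obj X := (Quotient.out p).1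

theorem isIrreducible_rep (p : Irr X) : p.rep.IsIrreducible := (Quotient.out p).2

/-- The class of an irreducible object. -/
def mk (A : Obj X) (hA : A.IsIrreducible) : Irr X := Quotient.mk _ ⟨A, hA⟩

theorem mk_rep (p : Irr X) : mk p.rep p.isIrreducible_rep = p := Quotient.out_eq p

theorem mk_eq_mk {A B : Obj X} (hA : A.IsIrreducible) (hB : B.IsIrreducible) :
    mk A hA = mk B hB ↔ Nonempty (A ≅ B) := Quotient.eq

theorem character_mk (A : Obj X) (hA : A.IsIrreducible) : (mk A hA).character = A.character := rfl

theorem character_rep (p : Irr X) : p.rep.character = p.character := by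
  rw [← character_mk _ p.isIrreducible_rep, mk_rep]

theorem nonempty_iso_rep_mk {A : Obj X} (hA : A.IsIrreducible) : Nonempty (A ≅ (mk A hA).rep) := by
  rw [← mk_eq_mk hA (mk A hA).isIrreducible_rep, mk_rep]

/-- Orthogonality of characters. -/
theorem sum_character_mul_character [Fintype G] [DecidableEq (Irr X)] (p q : Irr X) :
    ∑ m : M, ∑ g : G, p.character m g⁻¹ * q.character m g =
      if p = q then (Fintype.card G : ℂ) else 0 := by
  rw [← p.character_rep, ← q.character_rep, ← Obj.trace_average]
  split_ifs with h
  · subst h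
    exact p.isIrreducible_rep.trace_average_self
  · refine p.isIrreducible_rep.trace_average_eq_zero q.isIrreducible_rep ⟨fun e => h ?_⟩
    rw [← p.mk_rep, ← q.mk_rep, mk_eq_mk]
    exact ⟨e⟩

/-- Pairing a linear relation with `ψ_p` leaves `|G|` times the coefficient of `p`. -/
theorem linearIndependent_character [Finite G] :
    LinearIndependent ℂ (Irr.character : Irr X → M → G → ℂ) := by
  classical
  cases nonempty_fintype G
  rw [linearIndependent_iff']
  intro s c hc p hp
  have h : ∑ m : M, ∑ g : G, p.character m g⁻¹ * (∑ q ∈ s, c q • q.character) m g =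
      ∑ q ∈ s, c q * ∑ m : M, ∑ g : G, p.character m g⁻¹ * q.character m g := by
    simp only [Finset.sum_apply, Pi.smul_apply, smul_eq_mul, Finset.mul_sum]
    symm
    rw [Finset.sum_comm]
    refine Finset.sum_congr rfl fun m _ => ?_
    rw [Finset.sum_comm]
    simp only [mul_left_comm]
  rw [hc] at h
  simp only [sum_character_mul_character, mul_ite, mul_zero, Finset.sum_ite_eq, hp, if_true,
    Pi.zero_apply, Finset.sum_const_zero] at h
  exact (mul_eq_zero.mp h.symm).resolve_right (Nat.cast_ne_zero.mpr Fintype.card_ne_zero)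

/-- An independent family in the finite-dimensional space of functions on `M × G` is finite. -/
instance finite [Finite G] : Finite (Irr X) :=
  (linearIndependent_character (X := X)).finite

end Irr

end CrossedModule

namespace CrossedModule

/-! ### Bijective boundary maps and doubles -/

section doubles

variable {G M : Type*} [Group G] [Group M] {X : CrossedModule G M}

theorem isomorphic_double_of_bijective (h : Function.Bijective X.bd) :
    X.Isomorphic (double G) := by
  let e : M ≃* G := MulEquiv.ofBijective X.bd h
  have he : ∀ m, e m = X.bd m := fun _ => rfl
  refine ⟨⟨MonoidHom.id G, X.bd, fun _ => rfl, fun m g => (X.bd_act m g).symm⟩,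
    ⟨MonoidHom.id G, e.symm.toMonoidHom, fun m => ?_, fun m g => ?_⟩, fun _ => rfl, fun _ => rfl,
    e.symm_apply_apply, e.apply_symm_apply⟩
  · exact e.apply_symm_apply m
  · obtain ⟨n, rfl⟩ := e.surjective m
    change X.act (e.symm (e n)) g = e.symm (g⁻¹ * e n * g)
    rw [e.symm_apply_apply, e.eq_symm_apply, he, he, X.bd_act]

/-- The boundary map of a double is the identity, so an isomorphism `f` satisfies `f.map₂ = f.map₁ ∘
∂` with both components bijective. -/
theorem Isomorphic.bijective_of_double {H : Type*} [Group H] (h : X.Isomorphic (double H)) :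
    Function.Bijective X.bd := by
  obtain ⟨f, k, h1, h2, h3, h4⟩ := h
  have hf : ∀ m, f.map₂ m = f.map₁ (X.bd m) := f.bd_map
  refine ⟨fun m n hmn => ?_, fun g => ⟨k.map₂ (f.map₁ g), ?_⟩⟩
  · rw [← h3 m, ← h3 n, hf, hf, hmn]
  · have h5 := hf (k.map₂ (f.map₁ g))
    rw [h4] at h5
    have h6 := congrArg k.map₁ h5
    rw [h1, h1] at h6
    exact h6.symm

theorem bd_kerAct (x : X.bd.ker) (c : X.Coker) : X.bd (X.kerAct x c) = 1 := by
  induction c using QuotientGroup.induction_on with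
  | H y =>
    change X.bd (X.act x y) = 1
    rw [X.bd_act, MonoidHom.mem_ker.mp x.2, mul_one, inv_mul_cancel]

theorem kerAct_one (x : X.bd.ker) : X.kerAct x 1 = x := X.act_one x

end doubles

variable {G M : Type} [Group G] [Group M] [Fintype M] {X : CrossedModule G M}

namespace Obj

/-! ### Characters are class functions -/

/-- Writing `P(m) Q(g)` as `Q(g) P(m^g)²` and rotating one factor under the trace produces `P(m^g)
P(m) Q(g) = 0`. -/
theorem character_eq_zero (A : Obj X) {m : M} {g : G} (h : X.act m g ≠ m) :
    A.character m g = 0 := by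
  have h1 : A.P m * A.Q g = A.Q g * A.P (X.act m g) * A.P (X.act m g) := by
    rw [mul_assoc, A.P_mul, if_pos rfl, A.P_Q]
  rw [character, h1, LinearMap.trace_mul_comm, ← A.P_Q, ← mul_assoc, A.P_mul, if_neg h, zero_mul,
    map_zero]

theorem character_conj (A : Obj X) (m : M) (g h : G) :
    A.character (X.act m h) (h⁻¹ * g * h) = A.character m g := by
  rw [character, character, map_mul A.Q, ← mul_assoc, LinearMap.trace_mul_comm, ← mul_assoc, ← A.P_Q,
    map_mul A.Q, mul_assoc, ← mul_assoc (A.Q h), ← map_mul A.Q h, mul_inv_cancel, map_one, one_mul]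

/-! ### Completeness of the irreducible characters -/

/-- The action `∑ₘ ∑_g f(m, g) P(m) Q(g)` of a function `f` on an object. -/
noncomputable def algAct [Fintype G] (A : Obj X) (f : M → G → ℂ) : A.V →ₗ[ℂ] A.V :=
  ∑ m : M, ∑ g : G, f m g • (A.P m * A.Q g)

section algAct

variable [Fintype G]

theorem algAct_apply (A : Obj X) (f : M → G → ℂ) (v : A.V) :
    A.algAct f v = ∑ m : M, ∑ g : G, f m g • A.P m (A.Q g v) := by
  simp [algAct, LinearMap.sum_apply]

theorem trace_algAct (A : Obj X) (f : M → G → ℂ) :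
    LinearMap.trace ℂ A.V (A.algAct f) = ∑ m : M, ∑ g : G, f m g * A.character m g := by
  simp [algAct, character]

/-- A class function acts by endomorphisms. -/
noncomputable def algActHom (A : Obj X) (f : M → G → ℂ)
    (hsupp : ∀ m g, X.act m g ≠ m → f m g = 0)
    (hconj : ∀ m g h, f (X.act m h) (h⁻¹ * g * h) = f m g) : A ⟶ A :=
  ({ lin := A.algAct f
     comm_P := fun k v => by
      classical
      rw [algAct_apply, algAct_apply, map_sum]
      refine Finset.sum_congr rfl fun m _ => ?_
      rw [map_sum]
      refine Finset.sum_congr rfl fun g _ => ?_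
      rw [map_smul]
      -- On the support of `f`, `P(m)` commutes with `Q(g)`, so both sides vanish unless `k = m`.
      by_cases h : X.act m g = m
      · by_cases hk : m = k
        · rw [← hk, P_P_self, P_Q_apply, P_Q_apply, h, P_P_self]
        · rw [P_Q_apply, h, P_mul_apply, P_mul_apply, if_neg hk, if_neg (Ne.symm hk), map_zero]
      · rw [hsupp m g h, zero_smul, zero_smul]
     comm_Q := fun h v => by
      rw [algAct_apply, algAct_apply, map_sum]
      refine Eq.trans ?_ ((X.actEquiv h).sum_comp fun m => A.Q h
        (∑ g : G, f m g • A.P m (A.Q g v)))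
      refine Finset.sum_congr rfl fun m _ => ?_
      rw [map_sum]
      -- Substituting `(m^h, h⁻¹gh)` for `(m, g)` is harmless because `f` is invariant under it.
      refine Eq.trans ?_ (Equiv.sum_comp (MulAut.conj h⁻¹).toEquiv fun g =>
        A.Q h (f (X.act m h) g • A.P (X.act m h) (A.Q g v)))
      refine Finset.sum_congr rfl fun g _ => ?_
      have hg : (MulAut.conj h⁻¹).toEquiv g = h⁻¹ * g * h := by simp
      rw [hg, hconj, map_smul, ← P_Q_apply, ← Q_mul_apply, ← Q_mul_apply]
      congr 4; group } : Hom A A)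

/-- The regular object, formed by the functions on `M × G`. -/
noncomputable def regular (X : CrossedModule G M) : Obj X where
  V := M × G → ℂ
  P m := { toFun := fun φ z => open Classical in if m = X.act z.1 z.2 then φ z else 0
           map_add' := fun φ χ => funext fun z => by
             simp only [Pi.add_apply]; split_ifs <;> simp
           map_smul' := fun r φ => funext fun z => by simp }
  Q := { toFun := fun g => LinearMap.funLeft ℂ ℂ fun z => (z.1, z.2 * g)
         map_one' := LinearMap.ext fun φ => funext fun z => by simp [LinearMap.funLeft_apply]
         map_mul' := fun g h => LinearMap.ext fun φ => funext fun z => by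
          simp [LinearMap.funLeft_apply, mul_assoc] }
  P_mul m n := LinearMap.ext fun φ => funext fun z => by
    classical
    change (if m = X.act z.1 z.2 then if n = X.act z.1 z.2 then φ z else 0 else 0) = _
    by_cases h : m = n
    · subst h
      rw [if_pos rfl]
      change _ = if m = X.act z.1 z.2 then φ z else 0
      split_ifs <;> rfl
    · rw [if_neg h]
      split_ifs with h1 h2
      · exact absurd (h1.trans h2.symm) h
      · rfl
      · rfl
  P_sum := LinearMap.ext fun φ => funext fun z => by
    rw [LinearMap.sum_apply, Finset.sum_apply, Finset.sum_eq_single (X.act z.1 z.2)]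
    · exact if_pos rfl
    · intro b _ hb; exact if_neg hb
    · simp
  P_Q m g := LinearMap.ext fun φ => funext fun z => by
    have h : m = X.act z.1 z.2 ↔ X.act m g = X.act z.1 (z.2 * g) := by
      rw [X.act_mul]; exact (X.actEquiv g).injective.eq_iff.symm
    classical
    change (if m = X.act z.1 z.2 then φ (z.1, z.2 * g) else 0) =
      if X.act m g = X.act z.1 (z.2 * g) then φ (z.1, z.2 * g) else 0
    split_ifs <;> tauto

/-- The regular object is faithful: acting on the delta function at `(m, g)` and evaluating at `(m,
1)` returns `f(m, g)`. -/
theorem eq_zero_of_algAct_regular {f : M → G → ℂ} (h : (regular X).algAct f = 0) : f = 0 := by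
  classical
  funext m g
  let φ : M × G → ℂ := Pi.single (m, g) 1
  let φ' : (regular X).V := φ
  let ev : (regular X).V →ₗ[ℂ] ℂ := LinearMap.proj (R := ℂ) (φ := fun _ : M × G => ℂ) (m, 1)
  have h1 : ev ((regular X).algAct f φ') = 0 := by rw [h]; rfl
  have h2 : ∀ (k : M) (l : G), ev (f k l • (regular X).P k ((regular X).Q l φ')) =
      if k = m then if l = g then f k l else 0 else 0 := fun k l => by
    change f k l • (if k = X.act m 1 then φ (m, 1 * l) else 0) = _
    rw [X.act_one, one_mul]
    by_cases hk : k = m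
    · by_cases hl : l = g
      · simp [hk, hl, φ]
      · simp [hk, hl, φ]
    · simp [hk]
  rw [algAct_apply, map_sum] at h1
  simp only [map_sum, h2] at h1
  simpa using h1

/-- A class function orthogonal to all irreducible characters vanishes. -/
theorem eq_zero_of_forall_sum_character {f : M → G → ℂ}
    (hsupp : ∀ m g, X.act m g ≠ m → f m g = 0)
    (hconj : ∀ m g h, f (X.act m h) (h⁻¹ * g * h) = f m g)
    (hf : ∀ A : Obj X, A.IsIrreducible → ∑ m : M, ∑ g : G, f m g * A.character m g = 0) :
    f = 0 := by
  suffices h : ∀ (A : Obj X) (v : A.V), A.algAct f v = 0 from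
    eq_zero_of_algAct_regular (X := X) (LinearMap.ext (h _))
  intro A
  induction A using induction_directSum with
  | iso e h =>
    intro w
    obtain ⟨v, rfl⟩ := (isoLin e).surjective w
    have h1 := congrArg (isoLin e) (h v)
    rw [algAct_apply] at h1 ⊢
    simpa only [map_sum, map_smul, isoLin_P, isoLin_Q, map_zero] using h1
  | zero A h => exact fun v => Subsingleton.elim _ _
  | irreducible A h =>
    -- A class function acts by a scalar `c`; the trace `c · dim A` is the pairing with the
    -- character, which is zero by assumption.
    obtain ⟨c, hc⟩ := h.exists_smul_id (A.algActHom f hsupp hconj)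
    have hc' : A.algAct f = c • LinearMap.id := hc
    have ht := A.trace_algAct f
    rw [hf A h, hc', map_smul, LinearMap.trace_id, smul_eq_mul] at ht
    have hc0 := (mul_eq_zero.mp ht).resolve_right h.finrank_ne_zero
    intro v
    rw [hc', hc0, zero_smul, LinearMap.zero_apply]
  | directSum A B hA hB =>
    rintro ⟨v, w⟩
    have h1 := hA v
    have h2 := hB w
    rw [algAct_apply] at h1 h2
    have h3 : (directSum A B).algAct f (v, w) =
        ∑ m : M, ∑ g : G, f m g • ((A.P m (A.Q g v), B.P m (B.Q g w)) : A.V × B.V) :=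
      algAct_apply _ _ _
    rw [h3]
    refine Prod.ext ?_ ?_
    · refine Eq.trans ?_ h1
      simp [Prod.fst_sum]
    · refine Eq.trans ?_ h2
      simp [Prod.snd_sum]

end algAct

/-! ### Constituents of the vacuum -/

theorem IsConstituent.of_iso {A B C : Obj X} (h : A.IsConstituent B) (e : B ≅ C) :
    A.IsConstituent C := by
  obtain ⟨D, ⟨e'⟩⟩ := h
  exact ⟨D, ⟨e.symm ≪≫ e'⟩⟩

theorem IsConstituent.of_iso_left {A B : Obj X} (e : B ≅ A) : A.IsConstituent B := by
  have e' : directSum A (zeroObj X) ≅ A :=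
    isoMk (A := directSum A (zeroObj X)) (B := A)
      (LinearEquiv.prodUnique (R := ℂ) (M := A.V) (M₂ := PUnit)) (fun _ _ => rfl) (fun _ _ => rfl)
  exact ⟨zeroObj X, ⟨e ≪≫ e'.symm⟩⟩

/-- The direct sum is commutative. -/
def directSumComm (A B : Obj X) : directSum A B ≅ directSum B A :=
  isoMk (A := directSum A B) (B := directSum B A) (LinearEquiv.prodComm ℂ A.V B.V)
    (fun _ _ => rfl) (fun _ _ => rfl)

theorem IsConstituent.directSum_right {A B : Obj X} (h : A.IsConstituent B) (C : Obj X) :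
    A.IsConstituent (directSum B C) := by
  obtain ⟨D, ⟨e⟩⟩ := h
  refine ⟨directSum D C, ⟨isoMk (A := directSum B C) (B := directSum A (directSum D C))
    ((LinearEquiv.prodCongr (isoLin e) (LinearEquiv.refl ℂ C.V)).trans
      (LinearEquiv.prodAssoc ℂ A.V D.V C.V)) (fun m v => ?_) (fun m v => ?_)⟩⟩
  · exact congrArg (fun z : A.V × D.V => (z.1, z.2, C.P m v.2)) (isoLin_P e m v.1)
  · exact congrArg (fun z : A.V × D.V => (z.1, z.2, C.Q m v.2)) (isoLin_Q e m v.1)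

/-- If all irreducible constituents of `B` are trivial, then `B` is a multiple of the identity
object. -/
theorem acts_trivially_of_constituents [Finite G] (B : Obj X)
    (h : ∀ A : Obj X, A.IsIrreducible → A.IsConstituent B → Nonempty (A ≅ trivial X)) :
    (∀ m, m ≠ 1 → ∀ v, B.P m v = 0) ∧ ∀ g v, B.Q g v = v := by
  cases nonempty_fintype G
  induction B using induction_directSum with
  | iso e ih =>
    obtain ⟨h1, h2⟩ := ih fun A hA hAB => h A hA (hAB.of_iso e)
    constructor
    · intro m hm w
      obtain ⟨v, rfl⟩ := (isoLin e).surjective w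
      rw [← isoLin_P, h1 m hm, map_zero]
    · intro g w
      obtain ⟨v, rfl⟩ := (isoLin e).surjective w
      rw [← isoLin_Q, h2]
  | zero A h => exact ⟨fun _ _ _ => Subsingleton.elim _ _, fun _ _ => Subsingleton.elim _ _⟩
  | irreducible A hA =>
    obtain ⟨e⟩ := h A hA (IsConstituent.of_iso_left (Iso.refl A))
    constructor
    · intro m hm v
      refine (isoLin e).injective ?_
      rw [isoLin_P, map_zero]
      exact (unitP_apply m _).trans (if_neg hm)
    · intro g v
      refine (isoLin e).injective ?_
      rw [isoLin_Q]; rfl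
  | directSum A B hA hB =>
    obtain ⟨h1, h2⟩ := hA fun C hC hCA => h C hC (hCA.directSum_right B)
    obtain ⟨h3, h4⟩ := hB fun C hC hCB =>
      h C hC ((hCB.directSum_right A).of_iso (directSumComm B A))
    exact ⟨fun m hm v => Prod.ext (h1 m hm v.1) (h3 m hm v.2),
      fun g v => Prod.ext (h2 g v.1) (h4 g v.2)⟩

/-- The vacuum detects `K` and `C`. For `k ≠ 1` in `K`, `P(k)` does not kill the constant function,
as its value at `(k, 1)` shows. For `g` outside `I`, `Q(g)` moves the indicator function of `K ×
{1}`. -/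
theorem bijective_bd_of_vacuum_constituents [Finite G]
    (h : ∀ A : Obj X, A.IsIrreducible → A.IsConstituent X.vacuum → Nonempty (A ≅ trivial X)) :
    Function.Bijective X.bd := by
  classical
  obtain ⟨hP, hQ⟩ := acts_trivially_of_constituents X.vacuum h
  constructor
  · rw [injective_iff_map_eq_one]
    intro k hk
    by_contra hk1
    have h1 := congrFun (hP k hk1 fun _ => (1 : ℂ)) (⟨k, hk⟩, 1)
    have h2 : (if k = X.kerAct ⟨k, hk⟩ 1 then (1 : ℂ) else 0) = 0 := h1
    rw [kerAct_one, if_pos rfl] at h2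
    exact one_ne_zero h2
  · intro g
    have h1 := congrFun (hQ g fun z => if z.2 = 1 then (1 : ℂ) else 0) (1, 1)
    have h2 : (if (1 : X.Coker) * (g : X.Coker) = 1 then (1 : ℂ) else 0) =
      if (1 : X.Coker) = 1 then 1 else 0 := h1
    rw [if_pos rfl, one_mul] at h2
    have h3 : (g : X.Coker) = 1 := by
      by_contra h3
      rw [if_neg h3] at h2
      exact zero_ne_one h2
    exact MonoidHom.mem_range.mp ((QuotientGroup.eq_one_iff g).mp h3)

theorem isIrreducible_trivial (X : CrossedModule G M) : (trivial X).IsIrreducible :=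
  ⟨inferInstanceAs (Nontrivial ℂ), fun W _ _ => (IsSimpleOrder.eq_bot_or_eq_top (α := Ideal ℂ) W)⟩

/-- Here `K × C` is a single point. -/
theorem nonempty_vacuum_iso_trivial [Finite G] (h : Function.Bijective X.bd) :
    Nonempty (X.vacuum ≅ trivial X) := by
  classical
  have hK : ∀ x : X.bd.ker, x = 1 := fun x => Subtype.ext <|
    (injective_iff_map_eq_one X.bd).mp h.1 _ x.2
  have hC : ∀ c : X.Coker, c = 1 := fun c => by
    induction c using QuotientGroup.induction_on with
    | H y => exact (QuotientGroup.eq_one_iff y).mpr (MonoidHom.mem_range.mpr (h.2 y))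
  let f : Hom X.vacuum (trivial X) :=
    { lin := LinearMap.proj (R := ℂ) (φ := fun _ : X.bd.ker × X.Coker => ℂ) (1, 1)
      comm_P := fun m φ => by
        refine Eq.trans ?_ (unitP_apply m _).symm
        change (if m = X.kerAct 1 1 then _ else 0) = _
        rw [kerAct_one]; rfl
      comm_Q := fun g (φ : X.bd.ker × X.Coker → ℂ) =>
        congrArg (fun c => φ (1, c)) (hC (1 * (g : X.Coker))) }
  refine ⟨isoOfBijective (A := X.vacuum) (B := trivial X) f ⟨fun φ χ hφ => funext fun z => ?_,
    fun c => ⟨fun _ => c, rfl⟩⟩⟩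
  have hz : z = (1, 1) := Prod.ext (hK z.1) (hC z.2)
  rw [hz]
  exact hφ

theorem isConstituent_vacuum_iff [Finite G] (h : Function.Bijective X.bd) {A : Obj X}
    (hA : A.IsIrreducible) : A.IsConstituent X.vacuum ↔ Nonempty (A ≅ trivial X) := by
  obtain ⟨e⟩ := nonempty_vacuum_iso_trivial h
  constructor
  · rintro ⟨C, ⟨e'⟩⟩
    have := hA.1
    obtain ⟨v, hv⟩ := exists_ne (0 : A.V)
    -- The summand inclusion, followed by the isomorphism of the vacuum with the identity object, is
    -- nonzero, so Schur's lemma applies.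
    have h0 : (directSumBicone A C).inl ≫ e'.inv ≫ e.hom ≠ 0 := fun h0 => hv <| by
      have h1 : (directSumBicone A C).inl = 0 :=
        (cancel_mono (e'.inv ≫ e.hom)).mp (h0.trans Limits.zero_comp.symm)
      exact congrArg Prod.fst (LinearMap.congr_fun (congrArg Hom.lin h1) v)
    exact ⟨isoOfBijective _ (hA.bijective (isIrreducible_trivial X) h0)⟩
  · rintro ⟨e'⟩
    exact IsConstituent.of_iso_left (e ≪≫ e'.symm)

/-! ### Transparent objects -/

/-- An object on which `P` is supported on `ker ∂` and `Q` is trivial on `im ∂`. -/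
structure IsTransparent (A : Obj X) : Prop where
  P_eq_zero : ∀ m, X.bd m ≠ 1 → ∀ v, A.P m v = 0
  Q_bd : ∀ m v, A.Q (X.bd m) v = v

theorem isTransparent_trivial (X : CrossedModule G M) : (trivial X).IsTransparent where
  P_eq_zero m hm v := (unitP_apply m v).trans (if_neg fun h => hm (by rw [h, map_one]))
  Q_bd _ _ := rfl

theorem isTransparent_vacuum [Finite G] (X : CrossedModule G M) : X.vacuum.IsTransparent where
  P_eq_zero m hm φ := funext fun z => if_neg fun h => hm (by rw [h, bd_kerAct])
  Q_bd m (φ : X.bd.ker × X.Coker → ℂ) := funext fun z => by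
    have h : ((X.bd m : G) : X.Coker) = 1 :=
      (QuotientGroup.eq_one_iff _).mpr (MonoidHom.mem_range.mpr ⟨m, rfl⟩)
    change φ (z.1, z.2 * (X.bd m : X.Coker)) = φ z
    rw [h, mul_one]

theorem IsConstituent.isTransparent {A B : Obj X} (h : A.IsConstituent B)
    (hB : B.IsTransparent) : A.IsTransparent := by
  obtain ⟨C, ⟨e⟩⟩ := h
  have h1 : ∀ v : A.V, ∃ w, isoLin e w = ((v, 0) : A.V × C.V) := fun v => (isoLin e).surjective _
  constructor
  · intro m hm v
    obtain ⟨w, hw⟩ := h1 v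
    have h2 := isoLin_P e m w
    rw [hB.P_eq_zero m hm, map_zero, hw] at h2
    exact (congrArg Prod.fst h2).symm
  · intro m v
    obtain ⟨w, hw⟩ := h1 v
    have h2 := isoLin_Q e (X.bd m) w
    rw [hB.Q_bd, hw] at h2
    exact (congrArg Prod.fst h2).symm

/-- Only `m` in `ker ∂` contributes, and there `∂m = 1`, while `Q(∂n)` is the identity on `A`. Hence
`A` enters only through its dimension, and its row of `B` is proportional to that of the identity
object. -/
theorem IsTransparent.sum_character_mul_character {A : Obj X} (hA : A.IsTransparent) (B : Obj X) :
    ∑ m : M, ∑ n : M, A.character m (X.bd n) * B.character n (X.bd m) =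
      Module.finrank ℂ A.V * ∑ n : M, B.character n 1 := by
  have h1 : ∀ m n : M, A.character m (X.bd n) * B.character n (X.bd m) =
      LinearMap.trace ℂ A.V (A.P m) * B.character n 1 := fun m n => by
    have hQ : A.Q (X.bd n) = 1 := LinearMap.ext (hA.Q_bd n)
    rw [character, hQ, mul_one]
    by_cases hm : X.bd m = 1
    · rw [hm]
    · have hP : A.P m = 0 := LinearMap.ext (hA.P_eq_zero m hm)
      rw [hP, map_zero, zero_mul, zero_mul]
  simp only [h1, ← Finset.mul_sum, ← Finset.sum_mul, ← map_sum]
  rw [A.P_sum, LinearMap.trace_one]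

end Obj

/-! ### Invertibility of the `S`-matrix -/

variable [Finite G]

/-- The matrix `∑_{m,n} ψ_p(m, ∂n) ψ_q(n, ∂m)`. -/
noncomputable def braidingMatrix (X : CrossedModule G M) : Matrix (Irr X) (Irr X) ℂ :=
  Matrix.of fun p q => ∑ m : M, ∑ n : M, p.character m (X.bd n) * q.character n (X.bd m)

theorem card_mul_card_ne_zero (X : CrossedModule G M) :
    (Nat.card M : ℂ) * (Nat.card X.Coker : ℂ) ≠ 0 :=
  mul_ne_zero (Nat.cast_ne_zero.mpr Nat.card_pos.ne') (Nat.cast_ne_zero.mpr Nat.card_pos.ne')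

/-- The two matrices differ by a nonzero scalar and entrywise conjugation, and neither affects
whether the determinant vanishes. -/
theorem isUnit_sMatrix_iff [Fintype (Irr X)] [DecidableEq (Irr X)] :
    IsUnit X.sMatrix ↔ IsUnit X.braidingMatrix := by
  have h : X.sMatrix = (1 / ((Nat.card M : ℂ) * (Nat.card X.Coker : ℂ))) •
      X.braidingMatrix.map (starRingEnd ℂ) := by
    ext p q
    simp [sMatrix, braidingMatrix, map_sum]
  have h0 : (1 / ((Nat.card M : ℂ) * (Nat.card X.Coker : ℂ))) ≠ 0 :=
    one_div_ne_zero X.card_mul_card_ne_zero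
  rw [h, Matrix.isUnit_iff_isUnit_det, Matrix.det_smul, isUnit_iff_ne_zero,
    Matrix.isUnit_iff_isUnit_det, isUnit_iff_ne_zero, ← RingHom.mapMatrix_apply,
    ← RingHom.map_det, mul_ne_zero_iff, and_iff_right (pow_ne_zero _ h0), map_ne_zero]

theorem Obj.nonempty_iso_trivial_of_isUnit [Fintype (Irr X)] [DecidableEq (Irr X)]
    (h : IsUnit X.braidingMatrix) {A : Obj X} (hA : A.IsIrreducible)
    (hAX : A.IsConstituent X.vacuum) : Nonempty (A ≅ trivial X) := by
  rw [← Irr.mk_eq_mk hA (isIrreducible_trivial X)]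
  by_contra hne
  have hrow : ∀ q, X.braidingMatrix (Irr.mk A hA) q = Module.finrank ℂ A.V *
      X.braidingMatrix (Irr.mk (trivial X) (isIrreducible_trivial X)) q := fun q => by
    rw [← q.mk_rep]
    refine ((hAX.isTransparent (isTransparent_vacuum X)).sum_character_mul_character q.rep).trans ?_
    congr 1
    refine Eq.trans ?_ ((isTransparent_trivial X).sum_character_mul_character q.rep).symm
    have h1 : Module.finrank ℂ (trivial X).V = 1 := Module.finrank_self ℂ
    rw [h1, Nat.cast_one, one_mul]
  have hinj := Matrix.vecMul_injective_iff_isUnit.mpr h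
  -- Proportional rows give a relation between two basis vectors, which is impossible if the classes
  -- differ.
  have h0 : Pi.single (Irr.mk A hA) 1 - (Module.finrank ℂ A.V : ℂ) •
      Pi.single (Irr.mk (trivial X) (isIrreducible_trivial X)) 1 = 0 := hinj <| by
    change Matrix.vecMul _ _ = Matrix.vecMul _ _
    rw [Matrix.sub_vecMul, Matrix.smul_vecMul, Matrix.single_one_vecMul, Matrix.single_one_vecMul,
      Matrix.zero_vecMul]
    funext q
    simp [hrow q]
  have h1 := congrFun h0 (Irr.mk A hA)
  simp [Pi.single_eq_of_ne hne] at h1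

/-- A vector in the kernel of the matrix becomes, through `∂⁻¹`, a class function orthogonal to all
irreducible characters. -/
theorem isUnit_braidingMatrix_of_bijective [Fintype (Irr X)] [DecidableEq (Irr X)]
    (h : Function.Bijective X.bd) : IsUnit X.braidingMatrix := by
  cases nonempty_fintype G
  rw [← Matrix.mulVec_injective_iff_isUnit]
  refine (injective_iff_map_eq_zero X.braidingMatrix.mulVecLin).mpr fun c hc => ?_
  let e : M ≃ G := Equiv.ofBijective X.bd h
  have he : ∀ m, e.symm (X.bd m) = m := e.symm_apply_apply
  let f : M → G → ℂ := fun m g => ∑ q : Irr X, c q * q.character (e.symm g) (X.bd m)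
  have hf : f = 0 := by
    refine Obj.eq_zero_of_forall_sum_character (X := X) (fun m g hm => ?_) (fun m g k => ?_)
      fun A hA => ?_
    · obtain ⟨n, rfl⟩ := h.2 g
      refine Finset.sum_eq_zero fun q _ => ?_
      rw [he, ← q.character_rep, Obj.character_eq_zero, mul_zero]
      -- Both `m^{∂n} = m` and `n^{∂m} = n` say that `m` and `n` commute, so exchanging the
      -- arguments preserves the support condition.
      intro h'
      apply hm
      rw [X.act_bd, mul_assoc, inv_mul_eq_iff_eq_mul] at h' ⊢
      exact h'.symm
    · obtain ⟨n, rfl⟩ := h.2 g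
      refine Finset.sum_congr rfl fun q _ => ?_
      rw [← X.bd_act, he, he, X.bd_act, ← q.character_rep, Obj.character_conj]
    · have h1 := congrFun hc (Irr.mk A hA)
      have h2 : ∑ q, (∑ m : M, ∑ n : M, A.character m (X.bd n) * q.character n (X.bd m)) * c q =
        0 := h1
      rw [← h2]
      simp only [f, Finset.sum_mul]
      rw [Finset.sum_comm (s := (Finset.univ : Finset (Irr X)))]
      refine Finset.sum_congr rfl fun m _ => ?_
      rw [Finset.sum_comm (s := (Finset.univ : Finset (Irr X))), ← e.sum_comp]
      refine Finset.sum_congr rfl fun n _ => Finset.sum_congr rfl fun q _ => ?_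
      change c q * q.character (e.symm (X.bd n)) (X.bd m) * A.character m (X.bd n) = _
      rw [he]; ring
  -- As `∂` is surjective, the pairs `(n, ∂m)` exhaust `M × G`, so `f = 0` is a linear relation
  -- among the characters.
  have h3 := Fintype.linearIndependent_iff.mp (Irr.linearIndependent_character (X := X)) c <| by
    funext n g
    obtain ⟨m, rfl⟩ := h.2 g
    have h4 := congrFun (congrFun hf m) (X.bd n)
    simp only [f, he] at h4
    simpa [Finset.sum_apply] using h4
  exact funext h3

end CrossedModule

namespace CrossedModule

variable {G M : Type} [Group G] [Group M] [Fintype M] {X : CrossedModule G M}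

namespace Obj

/-! ### Quantum traces -/

/-- Braiding `A` past its dual before evaluating inserts the inverse twist, which cancels the twist
in `ribbonTrace`. -/
theorem contractLeft_braidMap (A : Obj X) (v : A.V) (φ : Module.Dual ℂ A.V) :
    contractLeft ℂ A.V (braidMap X A.P (dualQ A) (v ⊗ₜ φ)) = φ (twistInv A v) := by
  rw [braidMap_tmul, map_sum, twistInv_apply, map_sum]
  rfl

/-- The linear map underlying an endomorphism of the identity object. -/
def endUnitLin (f : End (𝟙_ (Obj X))) : ℂ →ₗ[ℂ] ℂ := Hom.lin f

/-- The quantum trace is the trace of the underlying linear map. -/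
theorem ribbonTrace_lin_one {A : Obj X} (f : A ⟶ A) :
    endUnitLin (ribbonTrace f) 1 = LinearMap.trace ℂ A.V (Hom.lin f) := by
  classical
  have h : endUnitLin (ribbonTrace f) 1 =
      contractLeft ℂ A.V (braidMap X A.P (dualQ A)
        (TensorProduct.map (twistMap A ∘ₗ Hom.lin f) LinearMap.id
          (_root_.coevaluation ℂ A.V 1))) := rfl
  rw [h, coevaluation_apply_one]
  simp only [map_sum, TensorProduct.map_tmul, LinearMap.id_apply, contractLeft_braidMap,
    LinearMap.comp_apply, twistInv_twistMap]
  rw [LinearMap.trace_eq_matrix_trace ℂ (Module.Basis.ofVectorSpace ℂ A.V), Matrix.trace]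
  simp [LinearMap.toMatrix_apply]

/-- The double braiding is `∑ Q(∂n) P(m) ⊗ P(n) Q(∂m)`, and the trace is multiplicative on tensor
products. -/
theorem trace_double_braiding (A B : Obj X) :
    LinearMap.trace ℂ (A.V ⊗[ℂ] B.V) (Hom.lin ((β_ A B).hom ≫ (β_ B A).hom)) =
      ∑ m : M, ∑ n : M, A.character m (X.bd n) * B.character n (X.bd m) := by
  have h : braidMap X B.P A.Q ∘ₗ braidMap X A.P B.Q =
      ∑ m : M, ∑ n : M, TensorProduct.map (A.Q (X.bd n) * A.P m) (B.P n * B.Q (X.bd m)) := by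
    refine TensorProduct.ext' fun v w => ?_
    simp [braidMap_tmul, LinearMap.sum_apply]
  change LinearMap.trace ℂ (A.V ⊗[ℂ] B.V) (braidMap X B.P A.Q ∘ₗ braidMap X A.P B.Q) = _
  rw [h]
  simp only [map_sum, LinearMap.trace_tensorProduct', character]
  simp only [LinearMap.trace_mul_comm ℂ (A.Q _)]

theorem ribbonTrace_double_braiding (A B : Obj X) :
    endUnitLin (ribbonTrace ((β_ A B).hom ≫ (β_ B A).hom)) 1 =
      ∑ m : M, ∑ n : M, A.character m (X.bd n) * B.character n (X.bd m) :=
  (ribbonTrace_lin_one _).trans (trace_double_braiding A B)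

/-! ### Modularity -/

theorem lin_unit_apply (f : End (𝟙_ (Obj X))) (c : ℂ) :
    endUnitLin f c = c * endUnitLin f 1 := by
  have h := map_smul (endUnitLin f) c (1 : ℂ)
  rwa [smul_eq_mul, smul_eq_mul, mul_one] at h

/-- The endomorphisms of the identity object are the scalars. -/
noncomputable def endUnitEquiv (X : CrossedModule G M) : End (𝟙_ (Obj X)) ≃+* ℂ where
  toFun f := endUnitLin f 1
  invFun c := (c • 𝟙 (𝟙_ (Obj X)) : 𝟙_ (Obj X) ⟶ 𝟙_ (Obj X))
  left_inv f := hom_ext fun (c : ℂ) => ((lin_unit_apply f c).trans (mul_comm _ _)).symm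
  right_inv c := mul_one c
  map_mul' f g := (lin_unit_apply f (endUnitLin g 1)).trans (mul_comm _ _)
  map_add' _ _ := rfl

theorem finiteDimensional_hom (A B : Obj X) : FiniteDimensional ℂ (A ⟶ B) := by
  let F : (A ⟶ B) →ₗ[ℂ] (A.V →ₗ[ℂ] B.V) :=
    { toFun := Hom.lin
      map_add' := fun _ _ => rfl
      map_smul' := fun _ _ => rfl }
  exact Module.Finite.of_injective F fun _ _ h => Hom.ext h

end Obj

/-- Invertibility is transported along the ring isomorphism `End(𝟙) ≃ ℂ`, applied entrywise, and
along the enumeration `e` of the irreducible classes. -/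
theorem isUnit_ribbonTrace_iff [Fintype (Irr X)] [DecidableEq (Irr X)] {n : ℕ}
    (V : Fin n → Obj X) (hV : ∀ i, (V i).IsIrreducible) (e : Fin n ≃ Irr X)
    (he : ∀ i, e i = Irr.mk (V i) (hV i)) :
    IsUnit (Matrix.of fun i j => ribbonTrace ((β_ (V i) (V j)).hom ≫ (β_ (V j) (V i)).hom)) ↔
      IsUnit X.braidingMatrix := by
  rw [← Matrix.isUnit_submatrix_equiv e e,
    ← isUnit_map_iff (Obj.endUnitEquiv X).mapMatrix]
  have h : (Obj.endUnitEquiv X).mapMatrix (Matrix.of fun i j =>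
      ribbonTrace ((β_ (V i) (V j)).hom ≫ (β_ (V j) (V i)).hom)) =
      X.braidingMatrix.submatrix e e := by
    ext i j
    refine (Obj.ribbonTrace_double_braiding (V i) (V j)).trans ?_
    rw [Matrix.submatrix_apply, he, he]
    rfl
  rw [h]

/-- Finiteness, simplicity of the unit and semisimplicity hold for every finite crossed module, so
only the matrix condition is at stake. -/
theorem isModularTensorCategory_iff [Finite G] [Fintype (Irr X)] [DecidableEq (Irr X)] :
    IsModularTensorCategory (Obj X) ↔ IsUnit X.braidingMatrix := by
  constructor
  · intro h
    obtain ⟨n, V, hV, hu, hunit⟩ := h.nondegenerate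
    have hV' := fun i => (Obj.simple_iff_isIrreducible (V i)).mp (hV i)
    -- A list meeting each isomorphism class of simple objects exactly once is an enumeration of
    -- `Irr X`.
    have hb : Function.Bijective fun i => Irr.mk (V i) (hV' i) := by
      rw [Function.bijective_iff_existsUnique]
      intro p
      obtain ⟨i, ⟨e⟩, hi⟩ := hu p.rep
        ((Obj.simple_iff_isIrreducible p.rep).mpr p.isIrreducible_rep)
      refine ⟨i, ?_, fun j hj => hi j ?_⟩
      · dsimp only
        rw [← p.mk_rep, Irr.mk_eq_mk]
        exact ⟨e.symm⟩
      · dsimp only at hj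
        rw [← p.mk_rep, Irr.mk_eq_mk] at hj
        exact hj.elim fun e => ⟨e.symm⟩
    exact (isUnit_ribbonTrace_iff V hV' (Equiv.ofBijective _ hb) fun _ => rfl).mp hunit
  · intro h
    let e : Fin (Fintype.card (Irr X)) ≃ Irr X := (Fintype.equivFin (Irr X)).symm
    refine ⟨Obj.finiteDimensional_hom,
      (Obj.simple_iff_isIrreducible _).mpr (Obj.isIrreducible_trivial X),
      Obj.exists_iso_biproduct_simple, _, fun i => (e i).rep,
      fun i => (Obj.simple_iff_isIrreducible _).mpr (e i).isIrreducible_rep, fun A hA => ?_,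
      (isUnit_ribbonTrace_iff _ (fun i => (e i).isIrreducible_rep) e
        fun i => (e i).mk_rep.symm).mpr h⟩
    have hA' := (Obj.simple_iff_isIrreducible A).mp hA
    refine ⟨e.symm (Irr.mk A hA'), ?_, fun j hj => ?_⟩
    · dsimp only
      rw [e.apply_symm_apply]
      exact Irr.nonempty_iso_rep_mk hA'
    · rw [e.eq_symm_apply, eq_comm, ← (e j).mk_rep, Irr.mk_eq_mk]
      exact hj

end CrossedModule

/-! ### The five equivalent conditions -/

theorem mainTheorem9 {G M : Type} [Group G] [Group M] [Finite G] [Fintype M]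
    (X : CrossedModule G M) :
    Finite X.Irr ∧ ∀ [Fintype X.Irr] [DecidableEq X.Irr],
      List.TFAE [
        IsUnit X.sMatrix,
        IsModularTensorCategory X.Obj,
        ∀ A : X.Obj, A.IsIrreducible →
          (A.IsConstituent X.vacuum ↔ Nonempty (A ≅ CrossedModule.Obj.trivial X)),
        Function.Bijective X.bd,
        ∃ (H : Type) (_ : Group H) (_ : Finite H), X.Isomorphic (CrossedModule.double H)] := by
  refine ⟨inferInstance, ?_⟩
  intro _ _
  -- Condition 2 is tied to condition 1; conditions 1, 3 and 5 are each compared with the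
  -- bijectivity of `∂`.
  tfae_have 1 ↔ 2 :=
    CrossedModule.isUnit_sMatrix_iff.trans CrossedModule.isModularTensorCategory_iff.symm
  tfae_have 1 → 4 := fun h => CrossedModule.Obj.bijective_bd_of_vacuum_constituents fun _ hA hAX =>
    CrossedModule.Obj.nonempty_iso_trivial_of_isUnit (CrossedModule.isUnit_sMatrix_iff.mp h) hA hAX
  tfae_have 4 → 1 := fun h => CrossedModule.isUnit_sMatrix_iff.mpr
    (CrossedModule.isUnit_braidingMatrix_of_bijective h)
  tfae_have 3 → 4 := fun h => CrossedModule.Obj.bijective_bd_of_vacuum_constituents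
    fun A hA hAX => (h A hA).mp hAX
  tfae_have 4 → 3 := fun h _ hA => CrossedModule.Obj.isConstituent_vacuum_iff h hA
  tfae_have 4 → 5 := fun h => ⟨G, _, inferInstance, CrossedModule.isomorphic_double_of_bijective h⟩
  tfae_have 5 → 4 := fun ⟨_, _, _, h⟩ => h.bijective_of_double
  tfae_finish
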